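/- Let $I=(0,1)$, $0<a<b$, and identify $\mathbb{R}^2$ with $\mathbb{C}$. Let $f=-e_2$ be the gravitational load, $F(t)=\int_t^1 f(s)\,ds=-(1-t)e_2$, and $A(\theta)=\left(\frac{1-\theta}{a}+\frac{\theta}{b}\right)^{-1}$. Let $X=\{K\in W^{1,2}(I): K(0)=0\}$ and $\tilde X=\{K\in X: K(t)\in(-\frac{\pi}{2},0] \text{ for all } t\in[0,1)\}$. For $\theta\in L^\infty(I)$ let $K(\theta)\in\tilde X$ be the solution of the state equation $(A(\theta)K')'=-F\cdot ie^{iK}$ in $X'$, that is, $$\int_I A(\theta)K'\varphi'\,dt-\int_I (F\cdot ie^{iK})\,\varphi\,dt=0\quad\text{for all }\varphi\in X.$$ For $c_l>0$ put $J(K,\theta)=\int_I F\cdot e^{iK}\,dt+c_l\int_I\theta\,dt$ and $\hat J(\theta)=J(K(\theta),\theta)$. Call $\theta\in L^\infty(I;[0,1])$ a critical point of $\hat J$ if $D\hat J(\theta)(\eta)\ge 0$ for every $\eta\in L^\infty(I)$ with $\eta\ge 0$ a.e. on $\{\theta=0\}$ and $\eta\le 0$ a.e. on $\{\theta=1\}$.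 **Theorem.** There is a constant $c_0>0$ depending only on $a$ and $b$ such that the following holds for every $c_l>0$ and every $\theta\in L^\infty(I;[0,1])$. For all $\theta'$ in some $L^\infty(I)$-neighbourhood of $\theta$ (including $\theta$ itself) the solution $K(\theta')\in\tilde X$ of the state equation exists and is unique, so that $\hat J$ is defined near $\theta$, and $\hat J$ is Fréchet differentiable at $\theta$. If $\theta$ is a critical point of $\hat J$, or a minimiser of $\hat J$ over $L^\infty(I;[0,1])$ (an optimal design), then $\theta$ is classical and ordered: there is $t^*\in[0,1)$ such that $A(\theta)=b$ a.e. on $(0,t^*)$ and $A(\theta)=a$ a.e. on $(t^*,1)$, so the hard phase (if present) is placed first. If moreover $c_l<c_0$, then $t^*\in(0,1)$. -/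

import Mathlib

open MeasureTheory Set
open scoped ENNReal Topology

noncomputable section

namespace Beam

/-- Lebesgue measure on the interval `I = (0,1)`. -/
abbrev muI : Measure ℝ := volume.restrict (Ioo (0 : ℝ) 1)

/-- The Banach space `L^∞(I)`. -/
abbrev LInf : Type := Lp ℝ ∞ muI

/-- The set `L^∞(I; [0,1])` of admissible (relaxed) designs. -/
def admissible : Set LInf := {θ | ∀ᵐ t ∂muI, θ t ∈ Icc (0 : ℝ) 1}

/-- The gravitational load `f = -e₂`, with `ℝ²` identified with `ℂ`. -/
def load : ℝ → ℂ := fun _ => -Complex.I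

/-- `F(t) = ∫_t^1 f(s) ds`. -/
def loadF (t : ℝ) : ℂ := ∫ s in t..1, load s

/-- The unit tangent `e^{iK(t)}` of the beam with phase `K`. -/
def tangent (K : ℝ → ℝ) (t : ℝ) : ℂ := Complex.exp (Complex.I * (K t : ℂ))

/-- The relaxed coefficient `A(θ) = ((1-θ)/a + θ/b)⁻¹`. -/
def coeffA (a b θ : ℝ) : ℝ := ((1 - θ) / a + θ / b)⁻¹

/-- Membership in `X = {K ∈ W^{1,2}(I) : K(0) = 0}`: here an element of `W^{1,2}(I)` is given by
its absolutely continuous representative on `[0,1]`, whose a.e. derivative is square integrable.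
Only the values of `K` on `[0,1]` matter. -/
structure MemX (K : ℝ → ℝ) : Prop where
  absCont : AbsolutelyContinuousOnInterval K 0 1
  deriv_memLp : MemLp (deriv K) 2 muI
  zero_left : K 0 = 0

/-- Membership in `X̃ = {K ∈ X : K ∈ (-π/2, 0] on [0,1)}`. -/
structure MemXTilde (K : ℝ → ℝ) : Prop where
  memX : MemX K
  range : ∀ t ∈ Ico (0 : ℝ) 1, K t ∈ Ioc (-(Real.pi / 2)) 0

/-- `K` solves the state equation `(A(θ)K')' = - F · i e^{iK}` in the dual space `X'`, i.e.
`∫ A(θ) K' φ' - ∫ (F · i e^{iK}) φ = 0` for all `φ ∈ X`. -/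
def StateEq (a b : ℝ) (θ : LInf) (K : ℝ → ℝ) : Prop :=
  ∀ φ : ℝ → ℝ, MemX φ →
    (∫ t, coeffA a b (θ t) * deriv K t * deriv φ t ∂muI)
      - (∫ t, (inner ℝ (loadF t) (Complex.I * tangent K t)) * φ t ∂muI) = 0

/-- `K` is a solution in `X̃` of the state equation with design `θ`. -/
def IsState (a b : ℝ) (θ : LInf) (K : ℝ → ℝ) : Prop :=
  MemXTilde K ∧ StateEq a b θ K

open Classical in
/-- The state `K(θ)`: the solution in `X̃` of the state equation with design `θ`. The default
value is used only for `θ` for which there is no such solution. -/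
def state (a b : ℝ) (θ : LInf) : ℝ → ℝ :=
  if h : ∃ K : ℝ → ℝ, IsState a b θ K then h.choose else 0

/-- The compliance `J(K, θ) = ∫_I F · e^{iK} dt + c_l ∫_I θ dt`. -/
def compliance (cl : ℝ) (K : ℝ → ℝ) (θ : LInf) : ℝ :=
  (∫ t, inner ℝ (loadF t) (tangent K t) ∂muI) + cl * ∫ t, θ t ∂muI

/-- The reduced compliance `Ĵ(θ) = J(K(θ), θ)`, as a function on `L^∞(I)`. -/
def reducedCompliance (a b cl : ℝ) (θ : LInf) : ℝ :=
  compliance cl (state a b θ) θ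

/-- `θ` is a critical point of `Ĵ` under the constraint `0 ≤ θ ≤ 1`: `DĴ(θ)(η) ≥ 0` for all
`η ∈ L^∞(I)` with `η ≥ 0` a.e. on `{θ = 0}` and `η ≤ 0` a.e. on `{θ = 1}`. -/
def IsCritical (a b cl : ℝ) (θ : LInf) : Prop :=
  ∀ η : LInf, (∀ᵐ t ∂muI, θ t = 0 → 0 ≤ η t) → (∀ᵐ t ∂muI, θ t = 1 → η t ≤ 0) →
    0 ≤ fderiv ℝ (reducedCompliance a b cl) θ η

end Beam

end

/-!
Write `u = -K`, `B = 1 / A(θ) = (1 - θ) / a + θ / b` and `ω(t) = 1 - t`. Testing the weak state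
equation with primitives shows that it is equivalent to the integrated first-order system
`u(t) = ∫_0^t B M`, `M(t) = ∫_t^1 ω cos u` with `0 ≤ u < π/2` (`IsStateSol`), which involves the
design only through the coefficient `B`, an affine function of `θ`. The whole argument takes place
on such systems; the only calculus needed is that `g ↦ ∫_0^· g` and `f ↦ ∫_·^1 f` are adjoint
to each other (`integral_mul_eq_of_primitives`).

*Well-posedness.* Since `cos` is decreasing on `[0, π/2]`, the equation for the curvature `u'` is
strongly monotone in `L²` after truncation of `cos`, so Zarantonello's theorem gives a solution
(`exists_isSol`); a Gronwall-type argument shows that the truncation is inactive. The same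
monotonicity gives Lipschitz dependence of `u` and `M` on `B` in `L^∞`
(`IsStateSol.abs_sub_u_le`), hence uniqueness.

*Derivative.* The adjoint state `(w, m)` solves the linearised system `w(t) = ∫_0^t B m`,
`m(t) = ∫_t^1 ω (cos u - w sin u)`. Testing the differences of two state systems against it gives an
exact expansion of the compliance (`IsStateSol.compliance_sub_eq`) whose remainder is quadratic, so
the reduced compliance is differentiable with derivative `η ↦ ∫ (c_l - κ M m) η`, where
`κ = 1/a - 1/b`.

*Ordering.* One has `w ≥ 0` by a minimum principle. Where `m > 0`, the slope
`m' = -ω (cos u - w sin u)` is negative: otherwise `m` would increase up to the end point, where it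
vanishes. So `m`, and with it the sensitivity `M m`, decreases strictly as long as it is positive,
and `c_l - κ M m` changes sign at most once, from negative to positive, at some `T < 1`
(`IsStateSol.exists_threshold`). Testing the variational inequality with the characteristic function
of `(0, T)` shows that `θ` coincides with it. Finally `M(0) m(0)` has a positive lower bound in terms
of the bounds of `B` (`IsStateSol.sensitivityBound_le`), which forces `T > 0` for small `c_l`.
-/

noncomputable section

namespace Beam

/-! ### Monotone operators and adjoint primitives -/

/-- Zarantonello's theorem: a Lipschitz continuous, strongly monotone map of a Hilbert space has a
zero. For a small step size `τ` the map `x ↦ x - τ N x` is a contraction. -/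
theorem exists_zero_of_stronglyMonotone {H : Type*} [NormedAddCommGroup H] [InnerProductSpace ℝ H]
    [CompleteSpace H] (N : H → H) {α L : ℝ} (hα : 0 < α)
    (hmono : ∀ x y, α * ‖x - y‖ ^ 2 ≤ inner ℝ (N x - N y) (x - y))
    (hlip : ∀ x y, ‖N x - N y‖ ≤ L * ‖x - y‖) : ∃ x, N x = 0 := by
  -- Enlarging the Lipschitz constant makes the contraction factor `1 - α² / L'²` positive.
  set L' := max L (α + 1) with hL'
  have hL'0 : 0 < L' := lt_of_lt_of_le (by linarith) (le_max_right L (α + 1))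
  have hαL : α < L' := lt_of_lt_of_le (by linarith) (le_max_right L (α + 1))
  have hlip' : ∀ x y, ‖N x - N y‖ ≤ L' * ‖x - y‖ := fun x y =>
    (hlip x y).trans (mul_le_mul_of_nonneg_right (le_max_left _ _) (norm_nonneg _))
  set τ := α / L' ^ 2 with hτ
  have hτ0 : 0 < τ := by positivity
  set c := 1 - α ^ 2 / L' ^ 2 with hc
  have hc1 : c < 1 := by
    have : 0 < α ^ 2 / L' ^ 2 := by positivity
    linarith
  have hc0 : 0 < c := by
    have : α ^ 2 / L' ^ 2 < 1 := by
      rw [div_lt_one (by positivity)]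
      exact pow_lt_pow_left₀ hαL hα.le (by norm_num)
    linarith
  have key : ∀ x y, ‖(x - τ • N x) - (y - τ • N y)‖ ≤ Real.sqrt c * ‖x - y‖ := by
    intro x y
    have h1 : (x - τ • N x) - (y - τ • N y) = (x - y) - τ • (N x - N y) := by
      rw [smul_sub]; abel
    have h2 : ‖(x - y) - τ • (N x - N y)‖ ^ 2 ≤ c * ‖x - y‖ ^ 2 := by
      rw [norm_sub_sq_real, inner_smul_right, real_inner_comm, norm_smul, Real.norm_eq_abs,
        abs_of_pos hτ0]
      have h3 := hmono x y
      have h4 : ‖N x - N y‖ ^ 2 ≤ L' ^ 2 * ‖x - y‖ ^ 2 := by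
        rw [← mul_pow]; exact pow_le_pow_left₀ (norm_nonneg _) (hlip' x y) 2
      have h5 : τ * (α * ‖x - y‖ ^ 2) ≤ τ * inner ℝ (N x - N y) (x - y) :=
        mul_le_mul_of_nonneg_left h3 hτ0.le
      have h6 : τ ^ 2 * ‖N x - N y‖ ^ 2 ≤ τ ^ 2 * (L' ^ 2 * ‖x - y‖ ^ 2) :=
        mul_le_mul_of_nonneg_left h4 (by positivity)
      have h7 : τ ^ 2 * L' ^ 2 = α ^ 2 / L' ^ 2 := by rw [hτ]; field_simp
      have h8 : τ * α = α ^ 2 / L' ^ 2 := by rw [hτ]; field_simp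
      have h9 : τ ^ 2 * (L' ^ 2 * ‖x - y‖ ^ 2) = α ^ 2 / L' ^ 2 * ‖x - y‖ ^ 2 := by
        rw [← h7]; ring
      have h10 : τ * (α * ‖x - y‖ ^ 2) = α ^ 2 / L' ^ 2 * ‖x - y‖ ^ 2 := by
        rw [← h8]; ring
      rw [hc, mul_pow]
      nlinarith
    rw [h1]
    apply le_of_sq_le_sq _ (by positivity)
    rw [mul_pow, Real.sq_sqrt hc0.le]
    exact h2
  have hcontr : ContractingWith (Real.toNNReal (Real.sqrt c)) (fun x => x - τ • N x) := by
    refine ⟨?_, LipschitzWith.of_dist_le_mul fun x y => ?_⟩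
    · rw [Real.toNNReal_lt_one, Real.sqrt_lt' one_pos]
      simpa using hc1
    · rw [dist_eq_norm, dist_eq_norm, Real.coe_toNNReal _ (Real.sqrt_nonneg _)]
      exact key x y
  refine ⟨hcontr.fixedPoint, ?_⟩
  have h := hcontr.fixedPoint_isFixedPt
  have h' : hcontr.fixedPoint - τ • N hcontr.fixedPoint = hcontr.fixedPoint := h
  have h'' : τ • N hcontr.fixedPoint = 0 := by simpa using h'
  exact (smul_eq_zero.mp h'').resolve_left hτ0.ne'

/-- The operators `g ↦ ∫_0^· g` and `f ↦ ∫_·^1 f` are adjoint to each other. -/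
theorem integral_mul_primitive {f g : ℝ → ℝ} (hf : IntervalIntegrable f volume 0 1)
    (hg : IntervalIntegrable g volume 0 1) :
    ∫ t in (0 : ℝ)..1, f t * ∫ s in (0 : ℝ)..t, g s
      = ∫ t in (0 : ℝ)..1, g t * ∫ s in t..1, f s := by
  have hG := hg.absolutelyContinuousOnInterval_intervalIntegral (c := 0) (by simp)
  have hF := hf.absolutelyContinuousOnInterval_intervalIntegral (c := 1) (by simp)
  have key := hF.integral_mul_deriv_eq_deriv_mul hG
  simp only [intervalIntegral.integral_same, mul_zero, zero_mul, sub_zero, zero_sub] at key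
  have h1 : ∫ t in (0 : ℝ)..1, (∫ s in (1 : ℝ)..t, f s) * deriv (fun x => ∫ s in (0 : ℝ)..x, g s) t
      = - ∫ t in (0 : ℝ)..1, g t * ∫ s in t..1, f s := by
    rw [← intervalIntegral.integral_neg]
    apply intervalIntegral.integral_congr_ae
    filter_upwards [hg.ae_hasDerivAt_integral] with t ht ht1
    rw [(ht (uIoc_subset_uIcc ht1) 0 (by simp)).deriv, intervalIntegral.integral_symm t 1]
    ring
  have h2 : ∫ t in (0 : ℝ)..1, deriv (fun x => ∫ s in (1 : ℝ)..x, f s) t * (∫ s in (0 : ℝ)..t, g s)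
      = ∫ t in (0 : ℝ)..1, f t * ∫ s in (0 : ℝ)..t, g s := by
    apply intervalIntegral.integral_congr_ae
    filter_upwards [hf.ae_hasDerivAt_integral] with t ht ht1
    rw [(ht (uIoc_subset_uIcc ht1) 1 (by simp)).deriv]
  rw [h1, h2] at key
  linarith

/-- The form of `integral_mul_primitive` for functions known only on `[0,1]`. -/
theorem integral_mul_eq_of_primitives {f g u n : ℝ → ℝ} (hf : IntervalIntegrable f volume 0 1)
    (hg : IntervalIntegrable g volume 0 1) (hu : ∀ t ∈ Icc (0 : ℝ) 1, u t = ∫ s in (0 : ℝ)..t, g s)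
    (hn : ∀ t ∈ Icc (0 : ℝ) 1, n t = ∫ s in t..1, f s) :
    ∫ t in (0 : ℝ)..1, f t * u t = ∫ t in (0 : ℝ)..1, g t * n t := by
  have h1 : ∫ t in (0 : ℝ)..1, f t * u t = ∫ t in (0 : ℝ)..1, f t * ∫ s in (0 : ℝ)..t, g s := by
    apply intervalIntegral.integral_congr
    intro t ht
    rw [uIcc_of_le zero_le_one] at ht
    simp only [hu t ht]
  have h2 : ∫ t in (0 : ℝ)..1, g t * n t = ∫ t in (0 : ℝ)..1, g t * ∫ s in t..1, f s := by
    apply intervalIntegral.integral_congr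
    intro t ht
    rw [uIcc_of_le zero_le_one] at ht
    simp only [hn t ht]
  rw [h1, h2, integral_mul_primitive hf hg]

/-- Measurable coefficients `B = 1 / A(θ)` with `0 < β₀ ≤ B ≤ β₁`. -/
structure IsCoeff (β₀ β₁ : ℝ) (B : ℝ → ℝ) : Prop where
  meas : Measurable B
  pos : 0 < β₀
  lower : ∀ t, β₀ ≤ B t
  upper : ∀ t, B t ≤ β₁

/-- The first-order form `u' = B M`, `M' = -k(t, u)` on `[0,1]` of the boundary value problem
`-(B⁻¹ u')' = k(t, u)`, `u(0) = 0`, `u'(1) = 0`, in integrated form. The values of `u` and `M`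
outside `[0,1]` carry no information, except that they extend continuously. -/
structure IsSol (B : ℝ → ℝ) (k : ℝ → ℝ → ℝ) (u M : ℝ → ℝ) : Prop where
  cont_u : Continuous u
  cont_M : Continuous M
  u_eq : ∀ t ∈ Icc (0 : ℝ) 1, u t = ∫ s in (0 : ℝ)..t, B s * M s
  M_eq : ∀ t ∈ Icc (0 : ℝ) 1, M t = ∫ r in t..1, k r (u r)

section
variable {β₀ β₁ : ℝ} {B : ℝ → ℝ}

theorem IsCoeff.apply_pos (hB : IsCoeff β₀ β₁ B) (t : ℝ) : 0 < B t := hB.pos.trans_le (hB.lower t)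

theorem IsCoeff.abs_le (hB : IsCoeff β₀ β₁ B) (t : ℝ) : |B t| ≤ β₁ := by
  rw [abs_of_pos (hB.apply_pos t)]; exact hB.upper t

theorem IsCoeff.upper_pos (hB : IsCoeff β₀ β₁ B) : 0 < β₁ := (hB.apply_pos 0).trans_le (hB.upper 0)

theorem IsCoeff.intervalIntegrable (hB : IsCoeff β₀ β₁ B) (x y : ℝ) :
    IntervalIntegrable B volume x y := by
  apply (intervalIntegrable_const (c := β₁)).mono_fun hB.meas.aestronglyMeasurable
  refine Filter.Eventually.of_forall fun t => ?_
  simp only [Real.norm_eq_abs, abs_of_pos hB.upper_pos]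
  exact hB.abs_le t

theorem IsCoeff.intervalIntegrable_mul (hB : IsCoeff β₀ β₁ B) {M : ℝ → ℝ} (hM : Continuous M)
    (x y : ℝ) : IntervalIntegrable (fun s => B s * M s) volume x y :=
  (hB.intervalIntegrable x y).mul_continuousOn hM.continuousOn

variable {k : ℝ → ℝ → ℝ} {u M : ℝ → ℝ}

theorem IsSol.u_zero (h : IsSol B k u M) : u 0 = 0 := by
  rw [h.u_eq 0 (by simp)]; simp

theorem IsSol.M_one (h : IsSol B k u M) : M 1 = 0 := by
  rw [h.M_eq 1 (by simp)]; simp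

theorem IsSol.u_sub (h : IsSol B k u M) (hB : IsCoeff β₀ β₁ B) {s t : ℝ} (hs : s ∈ Icc (0 : ℝ) 1)
    (ht : t ∈ Icc (0 : ℝ) 1) : u t - u s = ∫ r in s..t, B r * M r := by
  rw [h.u_eq s hs, h.u_eq t ht, intervalIntegral.integral_interval_sub_left] <;>
    exact hB.intervalIntegrable_mul h.cont_M _ _

theorem IsSol.continuous_rhs (h : IsSol B k u M) (hk : Continuous (Function.uncurry k)) :
    Continuous fun r => k r (u r) :=
  hk.comp (continuous_id.prodMk h.cont_u)

theorem IsSol.M_sub (h : IsSol B k u M) (hk : Continuous (Function.uncurry k)) {s t : ℝ}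
    (hs : s ∈ Icc (0 : ℝ) 1) (ht : t ∈ Icc (0 : ℝ) 1) :
    M s - M t = ∫ r in s..t, k r (u r) := by
  have hc := h.continuous_rhs hk
  rw [h.M_eq s hs, h.M_eq t ht, sub_eq_iff_eq_add,
    intervalIntegral.integral_add_adjacent_intervals] <;>
    exact hc.intervalIntegrable _ _

theorem IsSol.u_le_u (h : IsSol B k u M) (hB : IsCoeff β₀ β₁ B) {s t : ℝ} (hs : 0 ≤ s)
    (hst : s ≤ t) (ht : t ≤ 1) (hM : ∀ r ∈ Icc s t, 0 ≤ M r) : u s ≤ u t := by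
  have h1 := h.u_sub hB ⟨hs, hst.trans ht⟩ ⟨hs.trans hst, ht⟩
  have h2 : 0 ≤ ∫ r in s..t, B r * M r :=
    intervalIntegral.integral_nonneg hst fun r hr => mul_nonneg (hB.apply_pos r).le (hM r hr)
  linarith

theorem IsSol.M_le_M (h : IsSol B k u M) (hk : Continuous (Function.uncurry k)) {s t : ℝ}
    (hs : 0 ≤ s) (hst : s ≤ t) (ht : t ≤ 1) (hq : ∀ r ∈ Icc s t, 0 ≤ k r (u r)) : M t ≤ M s := by
  have h1 := h.M_sub hk ⟨hs, hst.trans ht⟩ ⟨hs.trans hst, ht⟩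
  have h2 : 0 ≤ ∫ r in s..t, k r (u r) := intervalIntegral.integral_nonneg hst hq
  linarith

end

/-! ### Existence for monotone two-point boundary value problems -/

theorem muI_eq : muI = volume.restrict (Ioc (0 : ℝ) 1) :=
  Measure.restrict_congr_set Ioo_ae_eq_Ioc

theorem ae_muI_iff {p : ℝ → Prop} : (∀ᵐ t ∂muI, p t) ↔ ∀ᵐ t, t ∈ Ioc (0 : ℝ) 1 → p t := by
  rw [muI_eq, ae_restrict_iff' measurableSet_Ioc]

theorem integral_muI (f : ℝ → ℝ) : ∫ t, f t ∂muI = ∫ t in (0 : ℝ)..1, f t := by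
  rw [intervalIntegral.integral_of_le zero_le_one, muI_eq]

instance : IsProbabilityMeasure muI := ⟨by simp [muI]⟩

theorem intervalIntegrable_iff_muI (f : ℝ → ℝ) :
    IntervalIntegrable f volume 0 1 ↔ Integrable f muI := by
  rw [intervalIntegrable_iff_integrableOn_Ioc_of_le zero_le_one, IntegrableOn, muI_eq]

theorem ae_muI_mem : ∀ᵐ t ∂muI, t ∈ Ioo (0 : ℝ) 1 := ae_restrict_mem measurableSet_Ioo

theorem ae_muI_mem_Icc : ∀ᵐ t ∂muI, t ∈ Icc (0 : ℝ) 1 :=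
  ae_muI_mem.mono fun _ ht => Ioo_subset_Icc_self ht

theorem aestronglyMeasurable_of_continuousOn {f : ℝ → ℝ} (hf : ContinuousOn f (Icc 0 1)) :
    AEStronglyMeasurable f muI :=
  (hf.mono Ioo_subset_Icc_self).aestronglyMeasurable measurableSet_Ioo

/-- The Hilbert space `L²(I)`. -/
abbrev L2 : Type := Lp ℝ 2 muI

theorem L2.integrable (v : L2) : Integrable v muI := (Lp.memLp v).integrable (by norm_num)

theorem L2.intervalIntegrable (v : L2) : IntervalIntegrable v volume 0 1 :=
  (intervalIntegrable_iff_muI _).2 v.integrable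

theorem L2.integral_abs_le (v : L2) : ∫ t, |v t| ∂muI ≤ ‖v‖ := by
  have h1 : (∫ t, |v t| ∂muI) = (eLpNorm v 1 muI).toReal := by
    rw [eLpNorm_one_eq_lintegral_enorm, integral_eq_lintegral_of_nonneg_ae
      (Filter.Eventually.of_forall fun t => abs_nonneg _) v.integrable.1.norm]
    simp [← Real.enorm_eq_ofReal_abs]
  rw [h1, Lp.norm_def]
  exact ENNReal.toReal_mono (Lp.eLpNorm_ne_top v)
    (eLpNorm_le_eLpNorm_of_exponent_le (by norm_num) (Lp.memLp v).1)

/-- The primitive `∫_0^· v` of an `L²` function. -/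
def prim (v : L2) (t : ℝ) : ℝ := ∫ s in (0 : ℝ)..t, v s

theorem intervalIntegrable_sub_Icc {f : ℝ → ℝ} (hf : IntervalIntegrable f volume 0 1) {s t : ℝ}
    (hs : s ∈ Icc (0 : ℝ) 1) (ht : t ∈ Icc (0 : ℝ) 1) : IntervalIntegrable f volume s t := by
  apply hf.mono_set
  rw [uIcc_of_le zero_le_one]
  exact uIcc_subset_Icc hs ht

theorem continuousOn_prim (v : L2) : ContinuousOn (prim v) (Icc 0 1) := by
  have := intervalIntegral.continuousOn_primitive_interval (μ := volume) (f := v) (a := 0) (b := 1)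
    (by
      rw [uIcc_of_le zero_le_one, integrableOn_Icc_iff_integrableOn_Ioc]
      exact (intervalIntegrable_iff_integrableOn_Ioc_of_le zero_le_one).1 v.intervalIntegrable)
  rwa [uIcc_of_le zero_le_one] at this

theorem prim_sub (v v' : L2) {t : ℝ} (ht : t ∈ Icc (0 : ℝ) 1) :
    prim v t - prim v' t = ∫ s in (0 : ℝ)..t, (v s - v' s) := by
  rw [prim, prim, intervalIntegral.integral_sub] <;>
  exact intervalIntegrable_sub_Icc (L2.intervalIntegrable _) (by simp) ht

theorem abs_prim_sub_le (v v' : L2) {t : ℝ} (ht : t ∈ Icc (0 : ℝ) 1) :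
    |prim v t - prim v' t| ≤ ‖v - v'‖ := by
  rw [prim_sub v v' ht]
  calc |∫ s in (0 : ℝ)..t, (v s - v' s)| ≤ ∫ s in (0 : ℝ)..t, |v s - v' s| :=
        intervalIntegral.abs_integral_le_integral_abs ht.1
    _ ≤ ∫ s in (0 : ℝ)..1, |v s - v' s| := by
        apply intervalIntegral.integral_mono_interval le_rfl ht.1 ht.2
        · exact Filter.Eventually.of_forall fun t => abs_nonneg _
        · exact (v.intervalIntegrable.sub v'.intervalIntegrable).abs
    _ = ∫ s, |(v - v' : L2) s| ∂muI := by
        rw [← integral_muI]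
        apply integral_congr_ae
        filter_upwards [Lp.coeFn_sub v v'] with t ht
        rw [ht]; rfl
    _ ≤ ‖v - v'‖ := L2.integral_abs_le _

section
variable {k : ℝ → ℝ → ℝ}

theorem continuousOn_rhs (hk : Continuous (Function.uncurry k)) (v : L2) :
    ContinuousOn (fun r => k r (prim v r)) (Icc 0 1) :=
  hk.comp_continuousOn (continuousOn_id.prodMk (continuousOn_prim v))

theorem intervalIntegrable_rhs (hk : Continuous (Function.uncurry k)) (v : L2) :
    IntervalIntegrable (fun r => k r (prim v r)) volume 0 1 := by
  apply ContinuousOn.intervalIntegrable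
  rw [uIcc_of_le zero_le_one]; exact continuousOn_rhs hk v

/-- The moment `∫_·^1 k(r, ∫_0^r v) dr` produced by the curvature `v`. -/
def moment (k : ℝ → ℝ → ℝ) (v : L2) (t : ℝ) : ℝ := ∫ r in t..1, k r (prim v r)

theorem continuousOn_moment (hk : Continuous (Function.uncurry k)) (v : L2) :
    ContinuousOn (moment k v) (Icc 0 1) := by
  have h := intervalIntegral.continuousOn_primitive_interval_left (μ := volume)
    (f := fun r => k r (prim v r)) (a := 0) (b := 1)
    (by
      rw [uIcc_of_le zero_le_one]
      exact (continuousOn_rhs hk v).integrableOn_Icc)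
  rwa [uIcc_of_le zero_le_one] at h

theorem memLp_moment (hk : Continuous (Function.uncurry k)) (v : L2) :
    MemLp (moment k v) 2 muI := by
  obtain ⟨C, hC⟩ := isCompact_Icc.exists_bound_of_continuousOn (continuousOn_moment hk v)
  exact MemLp.of_bound (aestronglyMeasurable_of_continuousOn (continuousOn_moment hk v)) C
    (ae_muI_mem_Icc.mono fun t ht => hC t ht)

theorem moment_sub (hk : Continuous (Function.uncurry k)) (v v' : L2) {t : ℝ}
    (ht : t ∈ Icc (0 : ℝ) 1) :
    moment k v t - moment k v' t = ∫ r in t..1, (k r (prim v r) - k r (prim v' r)) := by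
  rw [moment, moment, intervalIntegral.integral_sub] <;>
  exact intervalIntegrable_sub_Icc (intervalIntegrable_rhs hk _) ht (by simp)

theorem abs_moment_sub_le (hk : Continuous (Function.uncurry k)) {L : ℝ}
    (hL : ∀ t ∈ Icc (0 : ℝ) 1, ∀ x y, |k t x - k t y| ≤ L * |x - y|) (hL0 : 0 ≤ L) (v v' : L2)
    {t : ℝ} (ht : t ∈ Icc (0 : ℝ) 1) :
    |moment k v t - moment k v' t| ≤ L * ‖v - v'‖ := by
  rw [moment_sub hk v v' ht]
  have h := intervalIntegral.norm_integral_le_of_norm_le_const (a := t) (b := 1)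
    (f := fun r => k r (prim v r) - k r (prim v' r)) (C := L * ‖v - v'‖) (fun r hr => by
      rw [uIoc_of_le ht.2] at hr
      have hr' : r ∈ Icc (0 : ℝ) 1 := ⟨ht.1.trans hr.1.le, hr.2⟩
      rw [Real.norm_eq_abs]
      exact (hL r hr' _ _).trans (mul_le_mul_of_nonneg_left (abs_prim_sub_le v v' hr') hL0))
  rw [Real.norm_eq_abs] at h
  refine h.trans ?_
  rw [abs_of_nonneg (by linarith [ht.2])]
  exact mul_le_of_le_one_right (by positivity) (by linarith [ht.1])

variable {β₀ β₁ : ℝ} {B : ℝ → ℝ}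

theorem memLp_inv_mul (hB : IsCoeff β₀ β₁ B) (v : L2) :
    MemLp (fun t => (B t)⁻¹ * v t) 2 muI := by
  refine (Lp.memLp v).of_le_mul (c := β₀⁻¹)
    (hB.meas.inv.aestronglyMeasurable.mul (Lp.aestronglyMeasurable v))
    (Filter.Eventually.of_forall fun t => ?_)
  rw [norm_mul, Real.norm_eq_abs, abs_of_pos (inv_pos.2 (hB.apply_pos t))]
  exact mul_le_mul_of_nonneg_right (inv_anti₀ hB.pos (hB.lower t)) (norm_nonneg _)

/-- Existence for `-(B⁻¹ u')' = k(t, u)`, `u(0) = 0`, `u'(1) = 0`, when `k` is nonincreasing and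
Lipschitz continuous in `u`. In terms of the curvature `v = u' ∈ L²` the problem reads
`B⁻¹ v - ∫_·^1 k(r, ∫_0^r v) dr = 0`, and the operator on the left is strongly monotone. -/
theorem exists_isSol (hB : IsCoeff β₀ β₁ B) (hk : Continuous (Function.uncurry k)) {L : ℝ}
    (hL0 : 0 ≤ L) (hL : ∀ t ∈ Icc (0 : ℝ) 1, ∀ x y, |k t x - k t y| ≤ L * |x - y|)
    (hanti : ∀ t ∈ Icc (0 : ℝ) 1, ∀ x y, (k t x - k t y) * (x - y) ≤ 0) :
    ∃ u M, IsSol B k u M := by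
  let P : L2 → L2 := fun v => (memLp_inv_mul hB v).toLp
  let Q : L2 → L2 := fun v => (memLp_moment hk v).toLp
  have hP : ∀ v v' : L2, (P v - P v' : L2) =ᵐ[muI] fun t => (B t)⁻¹ * (v - v' : L2) t := by
    intro v v'
    filter_upwards [Lp.coeFn_sub (P v) (P v'), (memLp_inv_mul hB v).coeFn_toLp,
      (memLp_inv_mul hB v').coeFn_toLp, Lp.coeFn_sub v v'] with t h1 h2 h3 h4
    rw [h1, h4, Pi.sub_apply, Pi.sub_apply, h2, h3]; ring
  have hQ : ∀ v v' : L2, (Q v - Q v' : L2) =ᵐ[muI] fun t => moment k v t - moment k v' t := by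
    intro v v'
    filter_upwards [Lp.coeFn_sub (Q v) (Q v'), (memLp_moment hk v).coeFn_toLp,
      (memLp_moment hk v').coeFn_toLp] with t h1 h2 h3
    rw [h1, Pi.sub_apply, h2, h3]
  have hmono : ∀ v v' : L2, β₁⁻¹ * ‖v - v'‖ ^ 2
      ≤ inner ℝ ((P v - Q v) - (P v' - Q v')) (v - v') := by
    intro v v'
    have e : (P v - Q v) - (P v' - Q v') = (P v - P v') - (Q v - Q v') := by abel
    rw [e, inner_sub_left]
    have h1 : β₁⁻¹ * ‖v - v'‖ ^ 2 ≤ inner ℝ (P v - P v') (v - v') := by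
      rw [← real_inner_self_eq_norm_sq, L2.inner_def, L2.inner_def, ← integral_const_mul]
      apply integral_mono_ae ((L2.integrable_inner _ _).const_mul _) (L2.integrable_inner _ _)
      filter_upwards [hP v v'] with t ht
      simp only [ht, RCLike.inner_apply, conj_trivial]
      have : β₁⁻¹ ≤ (B t)⁻¹ := inv_anti₀ (hB.apply_pos t) (hB.upper t)
      nlinarith [mul_self_nonneg ((v - v' : L2) t)]
    have h2 : inner ℝ (Q v - Q v') (v - v') ≤ 0 := by
      have h3 : inner ℝ (Q v - Q v') (v - v')
          = ∫ t in (0 : ℝ)..1, (v t - v' t) * (moment k v t - moment k v' t) := by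
        rw [L2.inner_def, ← integral_muI]
        apply integral_congr_ae
        filter_upwards [hQ v v', Lp.coeFn_sub v v'] with t h1 h2
        rw [h1, h2]; simp
      rw [h3, ← integral_mul_eq_of_primitives (u := fun t => prim v t - prim v' t)
        (f := fun r => k r (prim v r) - k r (prim v' r))
        ((intervalIntegrable_rhs hk v).sub (intervalIntegrable_rhs hk v'))
        (v.intervalIntegrable.sub v'.intervalIntegrable) (fun t ht => prim_sub v v' ht)
        (fun t ht => moment_sub hk v v' ht)]
      have := intervalIntegral.integral_nonneg (μ := volume) (zero_le_one' ℝ)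
        (f := fun t => -((k t (prim v t) - k t (prim v' t)) * (prim v t - prim v' t)))
        (fun t ht => by linarith [hanti t ht (prim v t) (prim v' t)])
      rw [intervalIntegral.integral_neg] at this
      linarith
    linarith
  have hlip : ∀ v v' : L2, ‖(P v - Q v) - (P v' - Q v')‖ ≤ (β₀⁻¹ + L) * ‖v - v'‖ := by
    intro v v'
    have e : (P v - Q v) - (P v' - Q v') = (P v - P v') - (Q v - Q v') := by abel
    rw [e, add_mul]
    refine (norm_sub_le _ _).trans (add_le_add ?_ ?_)
    · apply Lp.norm_le_mul_norm_of_ae_le_mul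
      filter_upwards [hP v v'] with t ht
      rw [ht, norm_mul, Real.norm_eq_abs, abs_of_pos (inv_pos.2 (hB.apply_pos t))]
      exact mul_le_mul_of_nonneg_right (inv_anti₀ hB.pos (hB.lower t)) (norm_nonneg _)
    · have h := Lp.norm_le_of_ae_bound (f := Q v - Q v') (C := L * ‖v - v'‖) (by positivity) (by
        filter_upwards [hQ v v', ae_muI_mem_Icc] with t ht ht'
        rw [ht, Real.norm_eq_abs]
        exact abs_moment_sub_le hk hL hL0 v v' ht')
      have h1 : measureUnivNNReal muI = 1 := by simp [measureUnivNNReal]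
      simpa [h1] using h
  obtain ⟨v, hv⟩ := exists_zero_of_stronglyMonotone (fun v => P v - Q v)
    (inv_pos.2 hB.upper_pos) hmono hlip
  have hv' : ∀ᵐ t ∂muI, v t = B t * moment k v t := by
    have h0 : P v = Q v := sub_eq_zero.1 hv
    filter_upwards [(memLp_inv_mul hB v).coeFn_toLp, (memLp_moment hk v).coeFn_toLp] with t h1 h2
    have h3 : (B t)⁻¹ * v t = moment k v t := by
      rw [← h1, ← h2]; exact congrArg (fun z : L2 => z t) h0
    rw [← h3, mul_inv_cancel_left₀ (hB.apply_pos t).ne']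
  -- Continuous extensions to `ℝ`, constant outside `[0,1]`.
  let p : ℝ → ℝ := fun t => projIcc 0 1 zero_le_one t
  have hp : Continuous p := continuous_subtype_val.comp continuous_projIcc
  have hpm : ∀ t, p t ∈ Icc (0 : ℝ) 1 := fun t => (projIcc 0 1 zero_le_one t).2
  have hpt : ∀ t ∈ Icc (0 : ℝ) 1, p t = t := fun t ht => by
    simp only [p, projIcc_of_mem zero_le_one ht]
  refine ⟨fun t => prim v (p t), fun t => moment k v (p t),
    (continuousOn_prim v).comp_continuous hp hpm, (continuousOn_moment hk v).comp_continuous hp hpm,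
    fun t ht => ?_, fun t ht => ?_⟩
  · simp only [hpt t ht, prim]
    apply intervalIntegral.integral_congr_ae
    rw [ae_muI_iff] at hv'
    filter_upwards [hv'] with s hs hs'
    rw [uIoc_of_le ht.1] at hs'
    have hs1 : s ∈ Icc (0 : ℝ) 1 := ⟨hs'.1.le, hs'.2.trans ht.2⟩
    rw [hpt s hs1]
    exact hs ⟨hs'.1, hs1.2⟩
  · simp only [hpt t ht, moment]
    apply intervalIntegral.integral_congr
    intro s hs
    rw [uIcc_of_le ht.2] at hs
    simp only [hpt s ⟨ht.1.trans hs.1, hs.2⟩]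

end

section
variable {β₀ β₁ : ℝ} {B : ℝ → ℝ} {k : ℝ → ℝ → ℝ} {u M : ℝ → ℝ}

theorem IsSol.abs_u_sub_le (h : IsSol B k u M) (hB : IsCoeff β₀ β₁ B) {s t C : ℝ} (hs : 0 ≤ s)
    (hst : s ≤ t) (ht : t ≤ 1) (hM : ∀ r ∈ Icc s t, |M r| ≤ C) :
    |u t - u s| ≤ β₁ * C * (t - s) := by
  rw [h.u_sub hB ⟨hs, hst.trans ht⟩ ⟨hs.trans hst, ht⟩]
  have := intervalIntegral.norm_integral_le_of_norm_le_const (a := s) (b := t)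
    (f := fun r => B r * M r) (C := β₁ * C) (fun r hr => by
      rw [uIoc_of_le hst] at hr
      rw [norm_mul]
      exact mul_le_mul (hB.abs_le r) (hM r ⟨hr.1.le, hr.2⟩) (norm_nonneg _) hB.upper_pos.le)
  rwa [Real.norm_eq_abs, abs_of_nonneg (sub_nonneg.2 hst)] at this

theorem IsSol.abs_M_sub_le (h : IsSol B k u M) (hk : Continuous (Function.uncurry k)) {s t C : ℝ}
    (hs : 0 ≤ s) (hst : s ≤ t) (ht : t ≤ 1) (hq : ∀ r ∈ Icc s t, |k r (u r)| ≤ C) :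
    |M s - M t| ≤ C * (t - s) := by
  rw [h.M_sub hk ⟨hs, hst.trans ht⟩ ⟨hs.trans hst, ht⟩]
  have := intervalIntegral.norm_integral_le_of_norm_le_const (a := s) (b := t)
    (f := fun r => k r (u r)) (C := C) (fun r hr => by
      rw [uIoc_of_le hst] at hr
      exact hq r ⟨hr.1.le, hr.2⟩)
  rwa [Real.norm_eq_abs, abs_of_nonneg (sub_nonneg.2 hst)] at this

end

/-! ### The state equation -/

/-- Right-hand side of the state equation for `u = -K`. -/
def stateRhs (r x : ℝ) : ℝ := (1 - r) * Real.cos x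

/-- Truncation to `[0, π/2]`. -/
def clip (x : ℝ) : ℝ := max 0 (min x (Real.pi / 2))

/-- The right-hand side of the state equation, truncated so as to be nonincreasing in `x`. -/
def clipRhs (r x : ℝ) : ℝ := (1 - r) * Real.cos (clip x)

/-- The pair of the phase `u = -K` and the moment `M = A(θ) u'` of the beam. -/
structure IsStateSol (B u M : ℝ → ℝ) : Prop extends IsSol B stateRhs u M where
  range : ∀ t ∈ Icc (0 : ℝ) 1, u t ∈ Icc 0 (Real.pi / 2)

theorem clip_mem (x : ℝ) : clip x ∈ Icc 0 (Real.pi / 2) :=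
  ⟨le_max_left _ _, max_le (by positivity) (min_le_right _ _)⟩

theorem clip_of_mem {x : ℝ} (hx : x ∈ Icc 0 (Real.pi / 2)) : clip x = x := by
  rw [clip, min_eq_left hx.2, max_eq_right hx.1]

theorem clip_of_ge {x : ℝ} (hx : Real.pi / 2 ≤ x) : clip x = Real.pi / 2 := by
  rw [clip, min_eq_right hx, max_eq_right (by positivity)]

theorem clip_mono {x y : ℝ} (h : x ≤ y) : clip x ≤ clip y :=
  max_le_max le_rfl (min_le_min h le_rfl)

theorem abs_clip_sub_le (x y : ℝ) : |clip x - clip y| ≤ |x - y| := by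
  have h1 := abs_max_sub_max_le_abs (min x (Real.pi / 2)) (min y (Real.pi / 2)) 0
  rw [max_comm _ 0, max_comm _ 0] at h1
  refine h1.trans ?_
  simpa using abs_min_sub_min_le_max x (Real.pi / 2) y (Real.pi / 2)

theorem continuous_stateRhs : Continuous (Function.uncurry stateRhs) := by
  unfold Function.uncurry stateRhs; fun_prop

theorem continuous_clipRhs : Continuous (Function.uncurry clipRhs) := by
  unfold Function.uncurry clipRhs clip; fun_prop

theorem cos_nonneg_of_mem {x : ℝ} (hx : x ∈ Icc 0 (Real.pi / 2)) : 0 ≤ Real.cos x :=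
  Real.cos_nonneg_of_mem_Icc ⟨by linarith [hx.1, Real.pi_pos], hx.2⟩

theorem sin_nonneg_of_mem {x : ℝ} (hx : x ∈ Icc 0 (Real.pi / 2)) : 0 ≤ Real.sin x :=
  Real.sin_nonneg_of_nonneg_of_le_pi hx.1 (by linarith [hx.2, Real.pi_pos])

theorem cos_le_cos_of_mem {x y : ℝ} (hx : x ∈ Icc 0 (Real.pi / 2)) (hy : y ∈ Icc 0 (Real.pi / 2))
    (h : x ≤ y) : Real.cos y ≤ Real.cos x :=
  Real.cos_le_cos_of_nonneg_of_le_pi hx.1 (by linarith [hy.2, Real.pi_pos]) h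

theorem sin_le_sin_of_mem {x y : ℝ} (hx : x ∈ Icc 0 (Real.pi / 2)) (hy : y ∈ Icc 0 (Real.pi / 2))
    (h : x ≤ y) : Real.sin x ≤ Real.sin y :=
  Real.sin_le_sin_of_le_of_le_pi_div_two (by linarith [hx.1, Real.pi_pos]) hy.2 h

theorem clipRhs_mem {r : ℝ} (hr : r ∈ Icc (0 : ℝ) 1) (x : ℝ) : clipRhs r x ∈ Icc (0 : ℝ) 1 := by
  have h1 := cos_nonneg_of_mem (clip_mem x)
  have h2 := Real.cos_le_one (clip x)
  refine ⟨mul_nonneg (by linarith [hr.2]) h1, ?_⟩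
  exact mul_le_one₀ (by linarith [hr.1]) h1 h2

section
variable {β₀ β₁ : ℝ} {B : ℝ → ℝ} {u M : ℝ → ℝ}

theorem IsSol.M_nonneg_of_clip (h : IsSol B clipRhs u M) {t : ℝ} (ht : t ∈ Icc (0 : ℝ) 1) :
    0 ≤ M t := by
  rw [h.M_eq t ht]
  exact intervalIntegral.integral_nonneg ht.2 fun r hr =>
    (clipRhs_mem ⟨ht.1.trans hr.1, hr.2⟩ _).1

/-- The phase of the truncated equation stays strictly below `π/2`. If `t₀` is the first point
with `u(t₀) = π/2`, then `M(t₀) = 0`, and `π/2 - u` would satisfy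
`π/2 - u(t) ≤ β₁ (t₀ - t)² (π/2 - u(t))` to the left of `t₀`. -/
theorem IsSol.lt_pi_div_two_of_clip (hB : IsCoeff β₀ β₁ B) (h : IsSol B clipRhs u M) :
    ∀ t ∈ Icc (0 : ℝ) 1, u t < Real.pi / 2 := by
  by_contra! hcon
  obtain ⟨t₁, ht₁, hut₁⟩ := hcon
  have hmono : ∀ s t, 0 ≤ s → s ≤ t → t ≤ 1 → u s ≤ u t := fun s t hs hst ht =>
    h.u_le_u hB hs hst ht fun r hr => h.M_nonneg_of_clip ⟨hs.trans hr.1, hr.2.trans ht⟩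
  have hcpt : IsCompact (Icc (0 : ℝ) 1 ∩ {t | Real.pi / 2 ≤ u t}) :=
    isCompact_Icc.inter_right (isClosed_le continuous_const h.cont_u)
  obtain ⟨t₀, ⟨ht₀, hut₀⟩, hleast⟩ := hcpt.exists_isLeast ⟨t₁, ht₁, hut₁⟩
  simp only [mem_ofPred_eq] at hut₀
  have ht₀pos : 0 < t₀ := by
    rcases ht₀.1.eq_or_lt with h0 | h0
    · rw [← h0, h.u_zero] at hut₀
      linarith [Real.pi_pos]
    · exact h0
  have hM₀ : M t₀ = 0 := by
    rw [h.M_eq t₀ ht₀, ← intervalIntegral.integral_zero (a := t₀) (b := 1) (μ := volume)]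
    apply intervalIntegral.integral_congr
    intro r hr
    rw [uIcc_of_le ht₀.2] at hr
    simp only [clipRhs, clip_of_ge (hut₀.trans (hmono t₀ r ht₀.1 hr.1 hr.2)),
      Real.cos_pi_div_two, mul_zero]
  -- A step `δ` with `β₁ δ² < 1`.
  set δ : ℝ := 1 / (1 + β₁) with hδ
  have hβ := hB.upper_pos
  have hδ0 : 0 < δ := by positivity
  have hδ1 : β₁ * δ ^ 2 < 1 := by
    rw [hδ, div_pow, one_pow, mul_one_div, div_lt_one (by positivity)]
    nlinarith
  set t := max 0 (t₀ - δ) with htdef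
  have ht0 : 0 ≤ t := le_max_left _ _
  have htt₀ : t < t₀ := max_lt ht₀pos (by linarith)
  have htδ : t₀ - t ≤ δ := by linarith [le_max_right 0 (t₀ - δ)]
  have hut : u t < Real.pi / 2 := by
    by_contra! hc
    exact absurd (hleast ⟨⟨ht0, htt₀.le.trans ht₀.2⟩, hc⟩) (not_le.2 htt₀)
  have hut0 : 0 ≤ u t := by
    have := hmono 0 t le_rfl ht0 (htt₀.le.trans ht₀.2)
    rwa [h.u_zero] at this
  set d := Real.pi / 2 - u t with hd
  have hd0 : 0 < d := by linarith
  have hrhs : ∀ r ∈ Icc t t₀, |clipRhs r (u r)| ≤ d := by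
    intro r hr
    have hr1 : r ∈ Icc (0 : ℝ) 1 := ⟨ht0.trans hr.1, hr.2.trans ht₀.2⟩
    rw [abs_of_nonneg (clipRhs_mem hr1 _).1]
    have h1 : Real.cos (clip (u r)) ≤ Real.cos (u t) := by
      have h2 := cos_le_cos_of_mem (clip_mem _) (clip_mem _)
        (clip_mono (hmono t r ht0 hr.1 hr1.2))
      rwa [clip_of_mem ⟨hut0, hut.le⟩] at h2
    have h3 : Real.cos (u t) ≤ d := by
      rw [← Real.sin_pi_div_two_sub]
      exact Real.sin_le hd0.le
    have h4 := cos_nonneg_of_mem (clip_mem (u r))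
    calc clipRhs r (u r) ≤ 1 * Real.cos (clip (u r)) :=
          mul_le_mul_of_nonneg_right (by linarith [hr1.1]) h4
      _ ≤ d := by linarith
  have hM : ∀ s ∈ Icc t t₀, |M s| ≤ d * δ := by
    intro s hs
    have h1 := h.abs_M_sub_le continuous_clipRhs (ht0.trans hs.1) hs.2 ht₀.2
      fun r hr => hrhs r ⟨hs.1.trans hr.1, hr.2⟩
    rw [hM₀, sub_zero] at h1
    exact h1.trans (mul_le_mul_of_nonneg_left (by linarith [hs.1]) hd0.le)
  have h1 := h.abs_u_sub_le hB ht0 htt₀.le ht₀.2 hM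
  have h2 : β₁ * (d * δ) * (t₀ - t) ≤ β₁ * (d * δ) * δ :=
    mul_le_mul_of_nonneg_left htδ (by positivity)
  have h3 : β₁ * (d * δ) * δ = (β₁ * δ ^ 2) * d := by ring
  have h4 : (β₁ * δ ^ 2) * d < 1 * d := mul_lt_mul_of_pos_right hδ1 hd0
  have h5 := le_abs_self (u t₀ - u t)
  linarith

theorem IsStateSol.clip (h : IsStateSol B u M) : IsSol B clipRhs u M where
  cont_u := h.cont_u
  cont_M := h.cont_M
  u_eq := h.u_eq
  M_eq t ht := by
    rw [h.M_eq t ht]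
    apply intervalIntegral.integral_congr
    intro r hr
    rw [uIcc_of_le ht.2] at hr
    simp only [stateRhs, clipRhs, clip_of_mem (h.range r ⟨ht.1.trans hr.1, hr.2⟩)]

theorem IsStateSol.lt_pi_div_two (h : IsStateSol B u M) (hB : IsCoeff β₀ β₁ B) :
    ∀ t ∈ Icc (0 : ℝ) 1, u t < Real.pi / 2 :=
  h.clip.lt_pi_div_two_of_clip hB

theorem IsStateSol.M_mem (h : IsStateSol B u M) {t : ℝ} (ht : t ∈ Icc (0 : ℝ) 1) :
    M t ∈ Icc (0 : ℝ) 1 := by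
  refine ⟨h.clip.M_nonneg_of_clip ht, ?_⟩
  have h1 := h.clip.abs_M_sub_le continuous_clipRhs ht.1 ht.2 le_rfl (C := 1) fun r hr => by
    have := clipRhs_mem ⟨ht.1.trans hr.1, hr.2⟩ (u r)
    rw [abs_of_nonneg this.1]; exact this.2
  rw [h.M_one, sub_zero] at h1
  linarith [le_abs_self (M t), ht.1]

theorem IsStateSol.u_mono (h : IsStateSol B u M) (hB : IsCoeff β₀ β₁ B) {s t : ℝ} (hs : 0 ≤ s)
    (hst : s ≤ t) (ht : t ≤ 1) : u s ≤ u t :=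
  h.u_le_u hB hs hst ht fun _ hr => (h.M_mem ⟨hs.trans hr.1, hr.2.trans ht⟩).1

theorem IsStateSol.M_anti (h : IsStateSol B u M) {s t : ℝ} (hs : 0 ≤ s)
    (hst : s ≤ t) (ht : t ≤ 1) : M t ≤ M s :=
  h.clip.M_le_M continuous_clipRhs hs hst ht fun _ hr =>
    (clipRhs_mem ⟨hs.trans hr.1, hr.2.trans ht⟩ _).1

theorem exists_isStateSol (hB : IsCoeff β₀ β₁ B) : ∃ u M, IsStateSol B u M := by
  obtain ⟨u, M, h⟩ := exists_isSol hB continuous_clipRhs (zero_le_one' ℝ) (fun t ht x y => by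
      rw [clipRhs, clipRhs, ← mul_sub, abs_mul, abs_of_nonneg (by linarith [ht.2])]
      refine mul_le_mul (by linarith [ht.1]) ?_ (abs_nonneg _) zero_le_one
      exact (Real.abs_cos_sub_cos_le _ _).trans (abs_clip_sub_le x y)) (fun t ht x y => by
      rw [clipRhs, clipRhs, ← mul_sub, mul_assoc]
      refine mul_nonpos_of_nonneg_of_nonpos (by linarith [ht.2]) ?_
      rcases le_total x y with hxy | hxy
      · have := cos_le_cos_of_mem (clip_mem x) (clip_mem y) (clip_mono hxy)
        exact mul_nonpos_of_nonneg_of_nonpos (by linarith) (by linarith)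
      · have := cos_le_cos_of_mem (clip_mem y) (clip_mem x) (clip_mono hxy)
        exact mul_nonpos_of_nonpos_of_nonneg (by linarith) (by linarith))
  have hr : ∀ t ∈ Icc (0 : ℝ) 1, u t ∈ Icc 0 (Real.pi / 2) := fun t ht => by
    refine ⟨?_, (h.lt_pi_div_two_of_clip hB t ht).le⟩
    have := h.u_le_u hB le_rfl ht.1 ht.2 fun r hr => h.M_nonneg_of_clip ⟨hr.1, hr.2.trans ht.2⟩
    rwa [h.u_zero] at this
  refine ⟨u, M, ⟨h.cont_u, h.cont_M, h.u_eq, fun t ht => ?_⟩, hr⟩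
  rw [h.M_eq t ht]
  apply intervalIntegral.integral_congr
  intro r hr'
  rw [uIcc_of_le ht.2] at hr'
  simp only [stateRhs, clipRhs, clip_of_mem (hr r ⟨ht.1.trans hr'.1, hr'.2⟩)]

end

section
variable {β₀ β₁ : ℝ} {B₀ B₁ u₀ u₁ M₀ M₁ : ℝ → ℝ}

theorem IsStateSol.sub_u_eq (hB₀ : IsCoeff β₀ β₁ B₀) (hB₁ : IsCoeff β₀ β₁ B₁)
    (h₀ : IsStateSol B₀ u₀ M₀) (h₁ : IsStateSol B₁ u₁ M₁) {t : ℝ} (ht : t ∈ Icc (0 : ℝ) 1) :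
    u₁ t - u₀ t = ∫ s in (0 : ℝ)..t, (B₁ s * M₁ s - B₀ s * M₀ s) := by
  rw [h₀.u_eq t ht, h₁.u_eq t ht, intervalIntegral.integral_sub
    (hB₁.intervalIntegrable_mul h₁.cont_M _ _) (hB₀.intervalIntegrable_mul h₀.cont_M _ _)]

theorem IsStateSol.sub_M_eq (h₀ : IsStateSol B₀ u₀ M₀) (h₁ : IsStateSol B₁ u₁ M₁) {t : ℝ}
    (ht : t ∈ Icc (0 : ℝ) 1) :
    M₁ t - M₀ t = ∫ r in t..1, (stateRhs r (u₁ r) - stateRhs r (u₀ r)) := by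
  rw [h₀.M_eq t ht, h₁.M_eq t ht, intervalIntegral.integral_sub
    ((h₁.continuous_rhs continuous_stateRhs).intervalIntegrable _ _)
    ((h₀.continuous_rhs continuous_stateRhs).intervalIntegrable _ _)]

/-- Energy estimate for the difference of two moments. -/
theorem IsStateSol.integral_abs_sub_M_le (hB₀ : IsCoeff β₀ β₁ B₀) (hB₁ : IsCoeff β₀ β₁ B₁)
    (h₀ : IsStateSol B₀ u₀ M₀) (h₁ : IsStateSol B₁ u₁ M₁) {ε : ℝ} (hε : 0 < ε)
    (hBε : ∀ᵐ t ∂muI, |B₁ t - B₀ t| ≤ ε) :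
    ∫ t in (0 : ℝ)..1, |M₁ t - M₀ t| ≤ ε / β₀ := by
  have hβ := hB₀.pos
  have hi₁ := hB₁.intervalIntegrable_mul h₁.cont_M 0 1
  have hi₀ := hB₀.intervalIntegrable_mul h₀.cont_M 0 1
  have hcM : Continuous fun t => M₁ t - M₀ t := h₁.cont_M.sub h₀.cont_M
  have key := integral_mul_eq_of_primitives
    (f := fun r => stateRhs r (u₁ r) - stateRhs r (u₀ r)) (((h₁.continuous_rhs continuous_stateRhs).sub
      (h₀.continuous_rhs continuous_stateRhs)).intervalIntegrable 0 1) (hi₁.sub hi₀)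
    (fun t ht => h₀.sub_u_eq hB₀ hB₁ h₁ ht) (fun t ht => h₀.sub_M_eq h₁ ht)
  have hneg : ∫ t in (0 : ℝ)..1,
      (stateRhs t (u₁ t) - stateRhs t (u₀ t)) * (u₁ t - u₀ t) ≤ 0 := by
    have := intervalIntegral.integral_nonneg (μ := volume) (zero_le_one' ℝ)
      (f := fun t => -((stateRhs t (u₁ t) - stateRhs t (u₀ t)) * (u₁ t - u₀ t)))
      (fun t ht => by
        rw [stateRhs, stateRhs, ← mul_sub, mul_assoc, neg_nonneg]
        refine mul_nonpos_of_nonneg_of_nonpos (by linarith [ht.2]) ?_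
        rcases le_total (u₁ t) (u₀ t) with hxy | hxy
        · have := cos_le_cos_of_mem (h₁.range t ht) (h₀.range t ht) hxy
          exact mul_nonpos_of_nonneg_of_nonpos (by linarith) (by linarith)
        · have := cos_le_cos_of_mem (h₀.range t ht) (h₁.range t ht) hxy
          exact mul_nonpos_of_nonpos_of_nonneg (by linarith) (by linarith))
    rw [intervalIntegral.integral_neg] at this
    linarith
  have hlow : ∫ t in (0 : ℝ)..1, (ε * |M₁ t - M₀ t| - ε ^ 2 / β₀)
      ≤ ∫ t in (0 : ℝ)..1, (B₁ t * M₁ t - B₀ t * M₀ t) * (M₁ t - M₀ t) := by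
    rw [← integral_muI, ← integral_muI]
    apply integral_mono_ae
    · exact (intervalIntegrable_iff_muI _).1 (Continuous.intervalIntegrable (by fun_prop) _ _)
    · exact (intervalIntegrable_iff_muI _).1 ((hi₁.sub hi₀).mul_continuousOn hcM.continuousOn)
    filter_upwards [hBε, ae_muI_mem_Icc] with t ht htI
    set D := M₁ t - M₀ t with hD
    have e : (B₁ t * M₁ t - B₀ t * M₀ t) * D = (B₁ t - B₀ t) * M₁ t * D + B₀ t * D ^ 2 := by
      rw [hD]; ring
    rw [e]
    have a1 : |(B₁ t - B₀ t) * M₁ t * D| ≤ ε * |D| := by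
      rw [abs_mul, abs_mul]
      refine mul_le_mul_of_nonneg_right ?_ (abs_nonneg _)
      have := h₁.M_mem htI
      rw [abs_of_nonneg this.1]
      nlinarith [this.1, this.2, abs_nonneg (B₁ t - B₀ t)]
    have a2 : β₀ * D ^ 2 ≤ B₀ t * D ^ 2 := mul_le_mul_of_nonneg_right (hB₀.lower t) (sq_nonneg _)
    -- Young's inequality `2 ε |D| ≤ β₀ D² + ε² / β₀`
    have a3 : 2 * ε * |D| - ε ^ 2 / β₀ ≤ β₀ * D ^ 2 := by
      have : 0 ≤ (β₀ * |D| - ε) ^ 2 / β₀ := by positivity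
      have e2 : (β₀ * |D| - ε) ^ 2 / β₀ = β₀ * |D| ^ 2 - 2 * ε * |D| + ε ^ 2 / β₀ := by
        field_simp; ring
      rw [e2, sq_abs] at this
      linarith
    linarith [neg_abs_le ((B₁ t - B₀ t) * M₁ t * D)]
  rw [← key] at hlow
  rw [intervalIntegral.integral_sub ((by fun_prop : Continuous fun t =>
    ε * |M₁ t - M₀ t|).intervalIntegrable _ _) intervalIntegrable_const,
    intervalIntegral.integral_const_mul] at hlow
  simp only [intervalIntegral.integral_const, sub_zero, one_smul] at hlow
  have h3 : ε * ∫ t in (0 : ℝ)..1, |M₁ t - M₀ t| ≤ ε * (ε / β₀) := by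
    have : ε * (ε / β₀) = ε ^ 2 / β₀ := by ring
    linarith
  exact le_of_mul_le_mul_left h3 hε

/-- Lipschitz dependence of the phase on the coefficient. -/
theorem IsStateSol.abs_sub_u_le (hB₀ : IsCoeff β₀ β₁ B₀) (hB₁ : IsCoeff β₀ β₁ B₁)
    (h₀ : IsStateSol B₀ u₀ M₀) (h₁ : IsStateSol B₁ u₁ M₁) {ε : ℝ} (hε : 0 < ε)
    (hBε : ∀ᵐ t ∂muI, |B₁ t - B₀ t| ≤ ε) {t : ℝ} (ht : t ∈ Icc (0 : ℝ) 1) :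
    |u₁ t - u₀ t| ≤ (1 + β₁ / β₀) * ε := by
  have hi₁ := hB₁.intervalIntegrable_mul h₁.cont_M 0 1
  have hi₀ := hB₀.intervalIntegrable_mul h₀.cont_M 0 1
  have hcM : Continuous fun t => ε + β₁ * |M₁ t - M₀ t| := by
    have := h₁.cont_M; have := h₀.cont_M; fun_prop
  rw [h₀.sub_u_eq hB₀ hB₁ h₁ ht]
  calc |∫ s in (0 : ℝ)..t, (B₁ s * M₁ s - B₀ s * M₀ s)|
      ≤ ∫ s in (0 : ℝ)..t, |B₁ s * M₁ s - B₀ s * M₀ s| :=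
        intervalIntegral.abs_integral_le_integral_abs ht.1
    _ ≤ ∫ s in (0 : ℝ)..1, |B₁ s * M₁ s - B₀ s * M₀ s| :=
        intervalIntegral.integral_mono_interval le_rfl ht.1 ht.2
          (Filter.Eventually.of_forall fun t => abs_nonneg _) (hi₁.sub hi₀).abs
    _ ≤ ∫ s in (0 : ℝ)..1, (ε + β₁ * |M₁ s - M₀ s|) := by
        rw [← integral_muI, ← integral_muI]
        apply integral_mono_ae ((intervalIntegrable_iff_muI _).1 (hi₁.sub hi₀).abs)
          ((intervalIntegrable_iff_muI _).1 (hcM.intervalIntegrable _ _))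
        filter_upwards [hBε, ae_muI_mem_Icc] with s hs hsI
        have e : B₁ s * M₁ s - B₀ s * M₀ s = (B₁ s - B₀ s) * M₁ s + B₀ s * (M₁ s - M₀ s) := by
          ring
        rw [e]
        refine (abs_add_le _ _).trans (add_le_add ?_ ?_)
        · have := h₁.M_mem hsI
          rw [abs_mul, abs_of_nonneg this.1]
          nlinarith [this.1, this.2, abs_nonneg (B₁ s - B₀ s)]
        · rw [abs_mul]
          exact mul_le_mul_of_nonneg_right (hB₀.abs_le s) (abs_nonneg _)
    _ = ε + β₁ * ∫ s in (0 : ℝ)..1, |M₁ s - M₀ s| := by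
        rw [intervalIntegral.integral_add intervalIntegrable_const
          ((by have := h₁.cont_M; have := h₀.cont_M; fun_prop : Continuous fun t =>
            β₁ * |M₁ t - M₀ t|).intervalIntegrable _ _), intervalIntegral.integral_const_mul]
        simp
    _ ≤ ε + β₁ * (ε / β₀) := by
        have := mul_le_mul_of_nonneg_left (h₀.integral_abs_sub_M_le hB₀ hB₁ h₁ hε hBε)
          hB₀.upper_pos.le
        linarith
    _ = (1 + β₁ / β₀) * ε := by ring

theorem IsStateSol.abs_sub_M_le (h₀ : IsStateSol B₀ u₀ M₀) (h₁ : IsStateSol B₁ u₁ M₁) {C : ℝ}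
    (hC : ∀ t ∈ Icc (0 : ℝ) 1, |u₁ t - u₀ t| ≤ C) {t : ℝ} (ht : t ∈ Icc (0 : ℝ) 1) :
    |M₁ t - M₀ t| ≤ C := by
  rw [h₀.sub_M_eq h₁ ht]
  have hC0 : 0 ≤ C := (abs_nonneg _).trans (hC t ht)
  have := intervalIntegral.norm_integral_le_of_norm_le_const (a := t) (b := 1)
    (f := fun r => stateRhs r (u₁ r) - stateRhs r (u₀ r)) (C := C) (fun r hr => by
      rw [uIoc_of_le ht.2] at hr
      have hr' : r ∈ Icc (0 : ℝ) 1 := ⟨ht.1.trans hr.1.le, hr.2⟩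
      rw [stateRhs, stateRhs, ← mul_sub, norm_mul, Real.norm_eq_abs, Real.norm_eq_abs,
        abs_of_nonneg (by linarith [hr'.2])]
      have h1 := (Real.abs_cos_sub_cos_le (u₁ r) (u₀ r)).trans (hC r hr')
      nlinarith [abs_nonneg (Real.cos (u₁ r) - Real.cos (u₀ r)), hr'.1])
  rw [Real.norm_eq_abs, abs_of_nonneg (sub_nonneg.2 ht.2)] at this
  nlinarith [ht.1]

/-- Uniqueness of the state; the coefficient matters only up to null sets. -/
theorem IsStateSol.unique (hB₀ : IsCoeff β₀ β₁ B₀) (hB₁ : IsCoeff β₀ β₁ B₁)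
    (h₀ : IsStateSol B₀ u₀ M₀) (h₁ : IsStateSol B₁ u₁ M₁) (hB : ∀ᵐ t ∂muI, B₁ t = B₀ t) {t : ℝ}
    (ht : t ∈ Icc (0 : ℝ) 1) : u₁ t = u₀ t := by
  have hβ := hB₀.pos
  have hβ₁ := hB₀.upper_pos
  -- Stability is available for every bound `ε > 0` of the vanishing difference `B₁ - B₀`.
  have h : |u₁ t - u₀ t| ≤ 0 := by
    apply le_of_forall_pos_le_add
    intro δ hδ
    have hc : 0 < 1 + β₁ / β₀ := by positivity
    have := h₀.abs_sub_u_le hB₀ hB₁ h₁ (div_pos hδ hc)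
      (hB.mono fun t ht => by rw [ht, sub_self, abs_zero]; positivity) ht
    rwa [mul_div_cancel₀ _ hc.ne', ← zero_add δ] at this
  exact sub_eq_zero.1 (abs_nonpos_iff.1 h)

end

/-! ### The adjoint equation -/

/-- Right-hand side of the adjoint equation at the phase `u`, the linearisation of `stateRhs` with
`stateRhs` itself as source term. -/
def adjRhs (u : ℝ → ℝ) (r x : ℝ) : ℝ := (1 - r) * (Real.cos (u r) - Real.sin (u r) * x)

theorem continuous_adjRhs {u : ℝ → ℝ} (hu : Continuous u) :
    Continuous (Function.uncurry (adjRhs u)) := by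
  unfold Function.uncurry adjRhs; fun_prop

section
variable {β₀ β₁ : ℝ} {B u M w m : ℝ → ℝ}

theorem IsSol.u_lt_u {k : ℝ → ℝ → ℝ} (h : IsSol B k u M) (hB : IsCoeff β₀ β₁ B) {s t : ℝ}
    (hs : 0 ≤ s) (hst : s < t) (ht : t ≤ 1) (hM : ∀ r ∈ Ioo s t, 0 < M r) : u s < u t := by
  have h1 := h.u_sub hB ⟨hs, hst.le.trans ht⟩ ⟨hs.trans hst.le, ht⟩
  have h2 : 0 < ∫ r in s..t, B r * M r :=
    intervalIntegral.intervalIntegral_pos_of_pos_on (hB.intervalIntegrable_mul h.cont_M _ _)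
      (fun r hr => mul_pos (hB.apply_pos r) (hM r hr)) hst
  linarith

theorem IsSol.u_gt_u {k : ℝ → ℝ → ℝ} (h : IsSol B k u M) (hB : IsCoeff β₀ β₁ B) {s t : ℝ}
    (hs : 0 ≤ s) (hst : s < t) (ht : t ≤ 1) (hM : ∀ r ∈ Ioo s t, M r < 0) : u t < u s := by
  have h1 := h.u_sub hB ⟨hs, hst.le.trans ht⟩ ⟨hs.trans hst.le, ht⟩
  have h2 : 0 < ∫ r in s..t, -(B r * M r) :=
    intervalIntegral.intervalIntegral_pos_of_pos_on (hB.intervalIntegrable_mul h.cont_M _ _).neg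
      (fun r hr => neg_pos.2 (mul_neg_of_pos_of_neg (hB.apply_pos r) (hM r hr))) hst
  rw [intervalIntegral.integral_neg] at h2
  linarith

theorem IsSol.M_lt_M {k : ℝ → ℝ → ℝ} (h : IsSol B k u M) (hk : Continuous (Function.uncurry k))
    {s t : ℝ} (hs : 0 ≤ s) (hst : s < t) (ht : t ≤ 1) (hq : ∀ r ∈ Ioo s t, 0 < k r (u r)) :
    M t < M s := by
  have h1 := h.M_sub hk ⟨hs, hst.le.trans ht⟩ ⟨hs.trans hst.le, ht⟩
  have h2 : 0 < ∫ r in s..t, k r (u r) :=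
    intervalIntegral.intervalIntegral_pos_of_pos_on ((h.continuous_rhs hk).intervalIntegrable _ _)
      hq hst
  linarith

theorem IsStateSol.exists_adjoint (hB : IsCoeff β₀ β₁ B) (hs : IsStateSol B u M) :
    ∃ w m, IsSol B (adjRhs u) w m := by
  apply exists_isSol hB (continuous_adjRhs hs.cont_u) (zero_le_one' ℝ)
  · intro t ht x y
    have e : adjRhs u t x - adjRhs u t y = -((1 - t) * Real.sin (u t)) * (x - y) := by
      rw [adjRhs, adjRhs]; ring
    rw [e, abs_mul, abs_neg]
    refine mul_le_mul_of_nonneg_right ?_ (abs_nonneg _)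
    rw [abs_mul, abs_of_nonneg (by linarith [ht.2])]
    exact mul_le_one₀ (by linarith [ht.1]) (abs_nonneg _) (Real.abs_sin_le_one _)
  · intro t ht x y
    have e : (adjRhs u t x - adjRhs u t y) * (x - y)
        = -((1 - t) * Real.sin (u t) * (x - y) ^ 2) := by
      rw [adjRhs, adjRhs]; ring
    rw [e, neg_nonpos]
    have := sin_nonneg_of_mem (hs.range t ht)
    have : 0 ≤ 1 - t := by linarith [ht.2]
    positivity

/-- Minimum principle for the adjoint equation: at a negative minimum of `w` the moment `m` would
be nonnegative, and `m` is strictly decreasing where `w < 0`, so `w` would be smaller to the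
left. -/
theorem IsStateSol.adjoint_nonneg (hB : IsCoeff β₀ β₁ B) (hs : IsStateSol B u M)
    (ha : IsSol B (adjRhs u) w m) {t : ℝ} (ht : t ∈ Icc (0 : ℝ) 1) : 0 ≤ w t := by
  by_contra! hneg
  obtain ⟨p, hp, hmin⟩ := isCompact_Icc.exists_isMinOn ⟨t, ht⟩ ha.cont_u.continuousOn
  have hmin' : ∀ s ∈ Icc (0 : ℝ) 1, w p ≤ w s := fun s hs => hmin hs
  have hwp : w p < 0 := (hmin' t ht).trans_lt hneg
  have hp0 : 0 < p := by
    rcases hp.1.eq_or_lt with h0 | h0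
    · rw [← h0, ha.u_zero] at hwp
      exact absurd hwp (lt_irrefl _)
    · exact h0
  have hmp : 0 ≤ m p := by
    by_contra! hc
    have hp1 : p < 1 := by
      rcases hp.2.eq_or_lt with h0 | h0
      · rw [h0, ha.M_one] at hc
        exact absurd hc (lt_irrefl _)
      · exact h0
    obtain ⟨δ, hδ, hδm⟩ := Metric.eventually_nhds_iff.1
      (ha.cont_M.continuousAt.eventually_lt continuousAt_const hc)
    have hlt : p < min 1 (p + δ) := lt_min hp1 (by linarith)
    have := ha.u_gt_u hB hp.1 hlt (min_le_left _ _) (fun r hr => by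
      apply hδm
      rw [Real.dist_eq, abs_of_pos (by linarith [hr.1])]
      linarith [hr.2.trans_le (min_le_right 1 (p + δ))])
    have h2 := hmin' (min 1 (p + δ)) ⟨hp0.le.trans hlt.le, min_le_left _ _⟩
    linarith
  obtain ⟨δ, hδ, hδw⟩ := Metric.eventually_nhds_iff.1
    (ha.cont_u.continuousAt.eventually_lt continuousAt_const hwp)
  have hlt : max 0 (p - δ) < p := max_lt hp0 (by linarith)
  have hmpos : ∀ s ∈ Ioo (max 0 (p - δ)) p, 0 < m s := by
    intro s hs'
    refine hmp.trans_lt (ha.M_lt_M (continuous_adjRhs hs.cont_u)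
      ((le_max_left _ _).trans hs'.1.le) hs'.2 hp.2 fun r hr => ?_)
    have hrδ : p - δ < r := (le_max_right 0 (p - δ)).trans_lt (hs'.1.trans hr.1)
    have hr0 : 0 < r := (le_max_left 0 (p - δ)).trans_lt (hs'.1.trans hr.1)
    have hrI : r ∈ Icc (0 : ℝ) 1 := ⟨hr0.le, hr.2.le.trans hp.2⟩
    have hwr : w r < 0 := hδw (by
      rw [Real.dist_eq, abs_sub_comm, abs_of_pos (by linarith [hr.2])]; linarith)
    have hcos : 0 < Real.cos (u r) := Real.cos_pos_of_mem_Ioo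
      ⟨by linarith [(hs.range r hrI).1, Real.pi_pos], hs.lt_pi_div_two hB r hrI⟩
    have hsin := sin_nonneg_of_mem (hs.range r hrI)
    exact mul_pos (by linarith [hr.2, hp.2]) (by nlinarith)
  have h1 := ha.u_lt_u hB (le_max_left _ _) hlt hp.2 hmpos
  have h2 := hmin' (max 0 (p - δ)) ⟨le_max_left _ _, hlt.le.trans hp.2⟩
  linarith

/-- Where the adjoint moment `m` is positive, its slope `-(1 - s) (cos u - w sin u)` is negative.
Otherwise `cos u - w sin u`, which decreases as long as `m > 0`, would stay nonpositive, so `m`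
would stay positive up to `1`, where it vanishes. -/
theorem IsStateSol.adjoint_slope_pos (hB : IsCoeff β₀ β₁ B) (hs : IsStateSol B u M)
    (ha : IsSol B (adjRhs u) w m) {s : ℝ} (hsI : s ∈ Icc (0 : ℝ) 1) (hm : 0 < m s) :
    0 < Real.cos (u s) - Real.sin (u s) * w s := by
  by_contra! hq
  have hcpt : IsCompact (Icc s 1 ∩ {t | m t ≤ 0}) :=
    isCompact_Icc.inter_right (isClosed_le ha.cont_M continuous_const)
  obtain ⟨t, ⟨ht, hmt⟩, hleast⟩ :=
    hcpt.exists_isLeast ⟨1, ⟨hsI.2, le_rfl⟩, by simp [ha.M_one]⟩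
  simp only [mem_ofPred_eq] at hmt
  have hpos : ∀ r ∈ Ico s t, 0 < m r := fun r hr => by
    by_contra! hc
    exact absurd (hleast ⟨⟨hr.1, hr.2.le.trans ht.2⟩, hc⟩) (not_le.2 hr.2)
  have hwmono : ∀ r ∈ Icc s t, w s ≤ w r := fun r hr => by
    rcases hr.1.eq_or_lt with h0 | h0
    · rw [h0]
    · exact (ha.u_lt_u hB hsI.1 h0 (hr.2.trans ht.2) fun x hx =>
        hpos x ⟨hx.1.le, hx.2.trans_le hr.2⟩).le
  have hint : ∫ r in s..t, -(adjRhs u r (w r)) = m t - m s := by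
    rw [intervalIntegral.integral_neg,
      ← ha.M_sub (continuous_adjRhs hs.cont_u) hsI ⟨hsI.1.trans ht.1, ht.2⟩]
    ring
  have hnn : 0 ≤ ∫ r in s..t, -(adjRhs u r (w r)) :=
    intervalIntegral.integral_nonneg ht.1 fun r hr => by
      have hrI : r ∈ Icc (0 : ℝ) 1 := ⟨hsI.1.trans hr.1, hr.2.trans ht.2⟩
      have hu := hs.u_mono hB hsI.1 hr.1 hrI.2
      have h1 := cos_le_cos_of_mem (hs.range s hsI) (hs.range r hrI) hu
      have h2 := sin_le_sin_of_mem (hs.range s hsI) (hs.range r hrI) hu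
      have h3 := sin_nonneg_of_mem (hs.range s hsI)
      have h4 := hs.adjoint_nonneg hB ha hsI
      have h5 : Real.sin (u s) * w s ≤ Real.sin (u r) * w r :=
        mul_le_mul h2 (hwmono r hr) h4 (h3.trans h2)
      rw [adjRhs, neg_nonneg]
      exact mul_nonpos_of_nonneg_of_nonpos (by linarith [hrI.2]) (by linarith)
  linarith

/-- The adjoint moment is strictly decreasing up to any point where it is positive. -/
theorem IsStateSol.adjoint_moment_lt (hB : IsCoeff β₀ β₁ B) (hs : IsStateSol B u M)
    (ha : IsSol B (adjRhs u) w m) {r s : ℝ} (hr : 0 ≤ r) (hrs : r < s) (hs1 : s ≤ 1)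
    (hm : 0 < m s) : m s < m r := by
  have hk := continuous_adjRhs hs.cont_u
  have hslope : ∀ x, 0 ≤ x → x < s → 0 < m x → 0 < adjRhs u x (w x) := fun x hx hxs hmx =>
    mul_pos (by linarith) (hs.adjoint_slope_pos hB ha ⟨hx, hxs.le.trans hs1⟩ hmx)
  have hpos : ∀ x ∈ Icc r s, 0 < m x := by
    by_contra! hc
    obtain ⟨y, hy, hmy⟩ := hc
    have hcpt : IsCompact (Icc r s ∩ {t | m t ≤ 0}) :=
      isCompact_Icc.inter_right (isClosed_le ha.cont_M continuous_const)
    obtain ⟨t, ⟨ht, hmt⟩, hgreatest⟩ := hcpt.exists_isGreatest ⟨y, hy, hmy⟩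
    simp only [mem_ofPred_eq] at hmt
    have hts : t < s := by
      rcases ht.2.eq_or_lt with h0 | h0
      · rw [h0] at hmt; linarith
      · exact h0
    have := ha.M_lt_M hk (hr.trans ht.1) hts hs1 fun x hx => by
      refine hslope x ((hr.trans ht.1).trans hx.1.le) hx.2 ?_
      by_contra! hc
      exact absurd (hgreatest ⟨⟨ht.1.trans hx.1.le, hx.2.le⟩, hc⟩) (not_le.2 hx.1)
    linarith
  exact ha.M_lt_M hk hr hrs hs1 fun x hx =>
    hslope x (hr.trans hx.1.le) hx.2 (hpos x ⟨hx.1.le, hx.2.le⟩)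

/-- The sensitivity `M m` is strictly decreasing up to any point where it is positive. -/
theorem IsStateSol.sensitivity_lt (hB : IsCoeff β₀ β₁ B) (hs : IsStateSol B u M)
    (ha : IsSol B (adjRhs u) w m) {r s : ℝ} (hr : 0 ≤ r) (hrs : r < s) (hs1 : s ≤ 1)
    (hP : 0 < M s * m s) : M s * m s < M r * m r := by
  have hM := (hs.M_mem ⟨hr.trans hrs.le, hs1⟩).1
  have hM' : 0 < M s := hM.lt_of_ne fun h0 => by rw [← h0, zero_mul] at hP; exact lt_irrefl _ hP
  have hm : 0 < m s := pos_of_mul_pos_right hP hM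
  have h1 := hs.adjoint_moment_lt hB ha hr hrs hs1 hm
  have h2 := hs.M_anti hr hrs.le hs1
  nlinarith

/-- The ordering of the sensitivity: a level `c > 0` of `M m` is attained at most once, from
above. -/
theorem IsStateSol.exists_threshold (hB : IsCoeff β₀ β₁ B) (hs : IsStateSol B u M)
    (ha : IsSol B (adjRhs u) w m) {c : ℝ} (hc : 0 < c) :
    ∃ T : ℝ, 0 ≤ T ∧ T < 1 ∧ (c < M 0 * m 0 → 0 < T) ∧ (∀ t ∈ Ioo 0 T, c < M t * m t) ∧
      ∀ t ∈ Ioo T 1, M t * m t < c := by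
  have hcont : Continuous fun t => M t * m t := hs.cont_M.mul ha.cont_M
  have hcpt : IsCompact (Icc (0 : ℝ) 1 ∩ {t | c ≤ M t * m t}) :=
    isCompact_Icc.inter_right (isClosed_le continuous_const hcont)
  by_cases hne : (Icc (0 : ℝ) 1 ∩ {t | c ≤ M t * m t}).Nonempty
  · obtain ⟨T, ⟨hT, hcT⟩, hgreatest⟩ := hcpt.exists_isGreatest hne
    simp only [mem_ofPred_eq] at hcT
    have hgt : ∀ t, T < t → t ≤ 1 → M t * m t < c := fun t ht ht1 => by
      by_contra! h0
      exact absurd (hgreatest ⟨⟨hT.1.trans ht.le, ht1⟩, h0⟩) (not_le.2 ht)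
    refine ⟨T, hT.1, ?_, fun h0 => ?_, fun t ht => ?_, fun t ht => hgt t ht.1 ht.2.le⟩
    · rcases hT.2.eq_or_lt with h1 | h1
      · rw [h1, ha.M_one, mul_zero] at hcT
        linarith
      · exact h1
    · rcases hT.1.eq_or_lt with h1 | h1
      · exfalso
        obtain ⟨δ, hδ, hδm⟩ := Metric.eventually_nhds_iff.1
          (continuousAt_const.eventually_lt hcont.continuousAt h0)
        have hx : 0 < min 1 (δ / 2) := lt_min one_pos (by linarith)
        have h2 := hgt _ (h1 ▸ hx) (min_le_left _ _)
        have h3 := @hδm (min 1 (δ / 2)) (by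
          rw [Real.dist_eq, sub_zero, abs_of_pos hx]
          linarith [min_le_right 1 (δ / 2)])
        linarith
      · exact h1
    · exact hcT.trans_lt (hs.sensitivity_lt hB ha ht.1.le ht.2 hT.2 (hc.trans_le hcT))
  · have hlt : ∀ t ∈ Icc (0 : ℝ) 1, M t * m t < c := fun t ht => by
      by_contra! h0
      exact hne ⟨t, ht, h0⟩
    refine ⟨0, le_rfl, one_pos, fun h0 => ?_, fun t ht => ?_, fun t ht => hlt t ⟨ht.1.le, ht.2.le⟩⟩
    · exact absurd h0 (not_lt.2 (hlt 0 (by simp)).le)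
    · exact absurd ht.1 (not_lt.2 ht.2.le)

/-- A positive lower bound for the sensitivity `M m` at the clamped end, in terms of bounds
`β₀ ≤ B ≤ β₁` of the coefficient. -/
def sensitivityBound (β₀ β₁ : ℝ) : ℝ :=
  let τ := min (1 / 2) (1 / (2 * β₁))
  7 / 16 * τ * min 1 (3 * β₀ * τ / (32 * β₁))

theorem sensitivityBound_pos (h₀ : 0 < β₀) (h₁ : 0 < β₁) : 0 < sensitivityBound β₀ β₁ := by
  unfold sensitivityBound; positivity

/-- With `τ` as in `sensitivityBound` one has `u ≤ 1/2` on `[0,τ]`, which bounds `M 0` from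
below. If `ε = m 0` were too small, then, since `m ≤ ε` everywhere, `w` would be small and `m` would
fall below zero so fast that `w(τ) < 0`. -/
theorem IsStateSol.sensitivityBound_le (hB : IsCoeff β₀ β₁ B) (hs : IsStateSol B u M)
    (ha : IsSol B (adjRhs u) w m) : sensitivityBound β₀ β₁ ≤ M 0 * m 0 := by
  have hβ₀ := hB.pos
  have hβ₁ := hB.upper_pos
  unfold sensitivityBound
  simp only
  set τ := min (1 / 2) (1 / (2 * β₁)) with hτ
  have hτ0 : 0 < τ := by positivity
  have hτ1 : τ ≤ 1 / 2 := min_le_left _ _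
  have hτ2 : β₁ * τ ≤ 1 / 2 := by
    have h1 : τ ≤ 1 / (2 * β₁) := min_le_right _ _
    calc β₁ * τ ≤ β₁ * (1 / (2 * β₁)) := mul_le_mul_of_nonneg_left h1 hβ₁.le
      _ = 1 / 2 := by field_simp
  have hI : ∀ t ∈ Icc 0 τ, t ∈ Icc (0 : ℝ) 1 := fun t ht => ⟨ht.1, by linarith [ht.2]⟩
  have hu : ∀ t ∈ Icc 0 τ, u t ≤ 1 / 2 := fun t ht => by
    have h1 := hs.abs_u_sub_le hB le_rfl ht.1 (hI t ht).2 (C := 1) fun r hr => by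
      have := hs.M_mem ⟨hr.1, hr.2.trans (hI t ht).2⟩
      rw [abs_of_nonneg this.1]; exact this.2
    rw [hs.u_zero, sub_zero, sub_zero, mul_one] at h1
    have h2 : β₁ * t ≤ β₁ * τ := mul_le_mul_of_nonneg_left ht.2 hβ₁.le
    linarith [le_abs_self (u t)]
  have hcos : ∀ t ∈ Icc 0 τ, 7 / 8 ≤ Real.cos (u t) := fun t ht => by
    have h1 := Real.one_sub_sq_div_two_le_cos (x := u t)
    nlinarith [hu t ht, (hs.range t (hI t ht)).1]
  have hM0 : 7 / 16 * τ ≤ M 0 := by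
    have h1 := hs.M_sub continuous_stateRhs (s := 0) (t := τ) (by simp) (hI τ ⟨hτ0.le, le_rfl⟩)
    have h2 : ∫ r in (0 : ℝ)..τ, (7 / 16 : ℝ) ≤ ∫ r in (0 : ℝ)..τ, stateRhs r (u r) := by
      apply intervalIntegral.integral_mono_on hτ0.le intervalIntegrable_const
        ((hs.continuous_rhs continuous_stateRhs).intervalIntegrable _ _)
      intro r hr
      have h3 := hcos r hr
      rw [stateRhs]
      nlinarith [hr.2]
    rw [intervalIntegral.integral_const, smul_eq_mul, sub_zero] at h2
    have h3 := (hs.M_mem (hI τ ⟨hτ0.le, le_rfl⟩)).1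
    linarith
  -- The positive part avoids a separate proof of `0 ≤ m 0`.
  set ε := max (m 0) 0 with hε
  have hmε : ∀ t ∈ Icc (0 : ℝ) 1, m t ≤ ε := fun t ht => by
    by_cases hm : 0 < m t
    · rcases ht.1.eq_or_lt with h0 | h0
      · rw [← h0]; exact le_max_left _ _
      · exact (hs.adjoint_moment_lt hB ha le_rfl h0 ht.2 hm).le.trans (le_max_left _ _)
    · exact (not_lt.1 hm).trans (le_max_right _ _)
  have hε0 : 0 ≤ ε := le_max_right _ _
  have hm0 : min 1 (3 * β₀ * τ / (32 * β₁)) ≤ ε := by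
    by_contra! hc
    have hε1 : ε < 1 := hc.trans_le (min_le_left _ _)
    have hε2 : ε < 3 * β₀ * τ / (32 * β₁) := hc.trans_le (min_le_right _ _)
    have hw : ∀ t ∈ Icc 0 τ, w t ≤ 1 / 2 := fun t ht => by
      rw [ha.u_eq t (hI t ht)]
      have h1 : ∫ s in (0 : ℝ)..t, B s * m s ≤ ∫ s in (0 : ℝ)..t, β₁ := by
        apply intervalIntegral.integral_mono_on ht.1 (hB.intervalIntegrable_mul ha.cont_M _ _)
          intervalIntegrable_const
        intro r hr
        have h2 := hmε r ⟨hr.1, hr.2.trans (hI t ht).2⟩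
        nlinarith [hB.apply_pos r, hB.upper r]
      rw [intervalIntegral.integral_const, smul_eq_mul, sub_zero] at h1
      nlinarith [ht.2]
    have hm : ∀ t ∈ Icc 0 τ, m t ≤ ε - 3 / 16 * t := fun t ht => by
      have h1 := ha.M_sub (continuous_adjRhs hs.cont_u) (s := 0) (by simp) (hI t ht)
      have h2 : ∫ r in (0 : ℝ)..t, (3 / 16 : ℝ) ≤ ∫ r in (0 : ℝ)..t, adjRhs u r (w r) := by
        apply intervalIntegral.integral_mono_on ht.1 intervalIntegrable_const
          ((ha.continuous_rhs (continuous_adjRhs hs.cont_u)).intervalIntegrable _ _)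
        intro r hr
        have hr' : r ∈ Icc 0 τ := ⟨hr.1, hr.2.trans ht.2⟩
        have h3 := hcos r hr'
        have h4 := hw r hr'
        have h5 := hs.adjoint_nonneg hB ha (hI r hr')
        have h6 := Real.sin_le_one (u r)
        have h7 : Real.sin (u r) * w r ≤ 1 / 2 := by nlinarith
        rw [adjRhs]
        nlinarith [hr'.2]
      rw [intervalIntegral.integral_const, smul_eq_mul, sub_zero] at h2
      linarith [le_max_left (m 0) 0]
    have hτI := hI τ ⟨hτ0.le, le_rfl⟩
    have hwτ : w τ ≤ β₁ * ε * τ - 3 / 32 * β₀ * τ ^ 2 := by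
      rw [ha.u_eq τ hτI]
      have h1 : ∫ s in (0 : ℝ)..τ, B s * m s ≤ ∫ s in (0 : ℝ)..τ, (β₁ * ε - 3 / 16 * β₀ * s) := by
        apply intervalIntegral.integral_mono_on hτ0.le (hB.intervalIntegrable_mul ha.cont_M _ _)
          (Continuous.intervalIntegrable (by fun_prop) _ _)
        intro r hr
        have h2 := mul_le_mul_of_nonneg_left (hm r hr) (hB.apply_pos r).le
        have h3 := mul_le_mul_of_nonneg_right (hB.upper r) hε0
        have h4 := mul_le_mul_of_nonneg_right (hB.lower r) hr.1
        linarith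
      rw [intervalIntegral.integral_sub intervalIntegrable_const
        (Continuous.intervalIntegrable (by fun_prop) _ _), intervalIntegral.integral_const,
        intervalIntegral.integral_const_mul, integral_id, smul_eq_mul] at h1
      linarith
    have h1 := hs.adjoint_nonneg hB ha hτI
    rw [lt_div_iff₀ (by positivity)] at hε2
    nlinarith
  have hpos : 0 < min 1 (3 * β₀ * τ / (32 * β₁)) := by positivity
  have hεm : ε = m 0 := by
    rcases max_choice (m 0) 0 with h | h
    · exact h
    · rw [← hε] at h; linarith
  rw [← hεm]
  exact mul_le_mul hM0 hm0 hpos.le ((by positivity : (0 : ℝ) ≤ 7 / 16 * τ).trans hM0)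

end

/-! ### Second-order expansion of the compliance -/

theorem abs_sub_sin_le_sq (h : ℝ) : |h - Real.sin h| ≤ h ^ 2 := by
  rcases le_total |h| 6 with h6 | h6
  · refine (Real.abs_sub_sin_le h).trans ?_
    rw [← sq_abs h]
    nlinarith [abs_nonneg h, sq_nonneg |h|]
  · refine (abs_sub _ _).trans ?_
    rw [← sq_abs h]
    nlinarith [Real.abs_sin_le_abs (x := h)]

theorem abs_one_sub_cos_le_sq (h : ℝ) : |1 - Real.cos h| ≤ h ^ 2 := by
  rw [abs_of_nonneg (by linarith [Real.cos_le_one h])]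
  nlinarith [Real.one_sub_sq_div_two_le_cos (x := h), sq_nonneg h]

theorem abs_mul_le_of_abs_le_one {c x y : ℝ} (hc : |c| ≤ 1) (hx : |x| ≤ y) : |c * x| ≤ y := by
  rw [abs_mul]
  exact (mul_le_of_le_one_left (abs_nonneg x) hc).trans hx

theorem abs_cos_sub_le (x y : ℝ) :
    |Real.cos x - Real.cos y + Real.sin y * (x - y)| ≤ 2 * (x - y) ^ 2 := by
  obtain ⟨h, rfl⟩ : ∃ h, x = y + h := ⟨x - y, by ring⟩
  have e : Real.cos (y + h) - Real.cos y + Real.sin y * (y + h - y)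
      = -Real.cos y * (1 - Real.cos h) + Real.sin y * (h - Real.sin h) := by
    rw [Real.cos_add]; ring
  have e2 : y + h - y = h := by ring
  rw [e, e2, two_mul]
  refine (abs_add_le _ _).trans (add_le_add ?_ ?_)
  · exact abs_mul_le_of_abs_le_one (by rw [abs_neg]; exact Real.abs_cos_le_one y)
      (abs_one_sub_cos_le_sq h)
  · exact abs_mul_le_of_abs_le_one (Real.abs_sin_le_one y) (abs_sub_sin_le_sq h)

theorem abs_sin_sub_le (x y : ℝ) :
    |Real.sin x - Real.sin y - Real.cos y * (x - y)| ≤ 2 * (x - y) ^ 2 := by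
  obtain ⟨h, rfl⟩ : ∃ h, x = y + h := ⟨x - y, by ring⟩
  have e : Real.sin (y + h) - Real.sin y - Real.cos y * (y + h - y)
      = -Real.sin y * (1 - Real.cos h) + -Real.cos y * (h - Real.sin h) := by
    rw [Real.sin_add]; ring
  have e2 : y + h - y = h := by ring
  rw [e, e2, two_mul]
  refine (abs_add_le _ _).trans (add_le_add ?_ ?_)
  · exact abs_mul_le_of_abs_le_one (by rw [abs_neg]; exact Real.abs_sin_le_one y)
      (abs_one_sub_cos_le_sq h)
  · exact abs_mul_le_of_abs_le_one (by rw [abs_neg]; exact Real.abs_cos_le_one y)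
      (abs_sub_sin_le_sq h)

section
variable {β₀ β₁ : ℝ} {B₀ B₁ u₀ u₁ M₀ M₁ w m : ℝ → ℝ}

/-- Exact expansion of the difference of two compliances: the first term on the right is linear in
`B₁ - B₀`, the others are of second order. Both the adjoint system and the difference of the two
state systems are tested against each other. -/
theorem IsStateSol.compliance_sub_eq (hB₀ : IsCoeff β₀ β₁ B₀) (hB₁ : IsCoeff β₀ β₁ B₁)
    (h₀ : IsStateSol B₀ u₀ M₀) (h₁ : IsStateSol B₁ u₁ M₁) (ha : IsSol B₀ (adjRhs u₀) w m) :
    (∫ t in (0 : ℝ)..1, (1 - t) * Real.sin (u₁ t)) - (∫ t in (0 : ℝ)..1, (1 - t) * Real.sin (u₀ t))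
      = (∫ t in (0 : ℝ)..1, (B₁ t - B₀ t) * (M₀ t * m t))
        + (∫ t in (0 : ℝ)..1, (B₁ t - B₀ t) * ((M₁ t - M₀ t) * m t))
        + ∫ t in (0 : ℝ)..1, (1 - t) *
          ((Real.cos (u₁ t) - Real.cos (u₀ t) + Real.sin (u₀ t) * (u₁ t - u₀ t)) * w t
            + (Real.sin (u₁ t) - Real.sin (u₀ t) - Real.cos (u₀ t) * (u₁ t - u₀ t))) := by
  have cu₀ := h₀.cont_u
  have cu₁ := h₁.cont_u
  have cM₀ := h₀.cont_M
  have cM₁ := h₁.cont_M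
  have cw := ha.cont_u
  have cm := ha.cont_M
  have hadj := continuous_adjRhs cu₀
  have hi₁ := hB₁.intervalIntegrable_mul cM₁ 0 1
  have hi₀ := hB₀.intervalIntegrable_mul cM₀ 0 1
  have hdB := (hB₁.intervalIntegrable 0 1).sub (hB₀.intervalIntegrable 0 1)
  have key₁ := integral_mul_eq_of_primitives (f := fun r => adjRhs u₀ r (w r))
    (g := fun s => B₁ s * M₁ s - B₀ s * M₀ s)
    ((ha.continuous_rhs hadj).intervalIntegrable 0 1) (hi₁.sub hi₀)
    (fun t ht => h₀.sub_u_eq hB₀ hB₁ h₁ ht) ha.M_eq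
  have key₂ := integral_mul_eq_of_primitives
    (f := fun r => stateRhs r (u₁ r) - stateRhs r (u₀ r)) (g := fun s => B₀ s * m s)
    (((h₁.continuous_rhs continuous_stateRhs).sub
      (h₀.continuous_rhs continuous_stateRhs)).intervalIntegrable 0 1)
    (hB₀.intervalIntegrable_mul cm 0 1) ha.u_eq (fun t ht => h₀.sub_M_eq h₁ ht)
  have e₁ : ∫ t in (0 : ℝ)..1, (B₁ t * M₁ t - B₀ t * M₀ t) * m t
      = (∫ t in (0 : ℝ)..1, (B₁ t - B₀ t) * (M₀ t * m t))
        + (∫ t in (0 : ℝ)..1, (B₁ t - B₀ t) * ((M₁ t - M₀ t) * m t))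
        + ∫ t in (0 : ℝ)..1, B₀ t * m t * (M₁ t - M₀ t) := by
    have i₁ : IntervalIntegrable (fun t => (B₁ t - B₀ t) * (M₀ t * m t)) volume 0 1 :=
      hdB.mul_continuousOn (cM₀.mul cm).continuousOn
    have i₂ : IntervalIntegrable (fun t => (B₁ t - B₀ t) * ((M₁ t - M₀ t) * m t)) volume 0 1 :=
      hdB.mul_continuousOn ((cM₁.sub cM₀).mul cm).continuousOn
    have i₃ : IntervalIntegrable (fun t => B₀ t * m t * (M₁ t - M₀ t)) volume 0 1 :=
      (hB₀.intervalIntegrable_mul cm 0 1).mul_continuousOn (cM₁.sub cM₀).continuousOn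
    rw [← intervalIntegral.integral_add i₁ i₂, ← intervalIntegral.integral_add (i₁.add i₂) i₃]
    apply intervalIntegral.integral_congr
    intro t _
    simp only
    ring
  have e₂ : (∫ t in (0 : ℝ)..1, (1 - t) * Real.sin (u₁ t))
        - (∫ t in (0 : ℝ)..1, (1 - t) * Real.sin (u₀ t))
      = (∫ t in (0 : ℝ)..1, adjRhs u₀ t (w t) * (u₁ t - u₀ t))
        - (∫ t in (0 : ℝ)..1, (stateRhs t (u₁ t) - stateRhs t (u₀ t)) * w t)
        + ∫ t in (0 : ℝ)..1, (1 - t) *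
          ((Real.cos (u₁ t) - Real.cos (u₀ t) + Real.sin (u₀ t) * (u₁ t - u₀ t)) * w t
            + (Real.sin (u₁ t) - Real.sin (u₀ t) - Real.cos (u₀ t) * (u₁ t - u₀ t))) := by
    unfold adjRhs stateRhs
    rw [← intervalIntegral.integral_sub (Continuous.intervalIntegrable (by fun_prop) _ _)
        (Continuous.intervalIntegrable (by fun_prop) _ _),
      ← intervalIntegral.integral_sub (Continuous.intervalIntegrable (by fun_prop) _ _)
        (Continuous.intervalIntegrable (by fun_prop) _ _),
      ← intervalIntegral.integral_add (Continuous.intervalIntegrable (by fun_prop) _ _)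
        (Continuous.intervalIntegrable (by fun_prop) _ _)]
    apply intervalIntegral.integral_congr
    intro t _
    simp only
    ring
  linarith

/-- The remainder of the expansion of the compliance is quadratic in `‖B₁ - B₀‖∞`. -/
theorem IsStateSol.abs_compliance_remainder_le (hB₀ : IsCoeff β₀ β₁ B₀) (hB₁ : IsCoeff β₀ β₁ B₁)
    (h₀ : IsStateSol B₀ u₀ M₀) (h₁ : IsStateSol B₁ u₁ M₁) (ha : IsSol B₀ (adjRhs u₀) w m)
    {ε C : ℝ} (hε : 0 < ε) (hBε : ∀ᵐ t ∂muI, |B₁ t - B₀ t| ≤ ε)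
    (hw : ∀ t ∈ Icc (0 : ℝ) 1, |w t| ≤ C) (hm : ∀ t ∈ Icc (0 : ℝ) 1, |m t| ≤ C) :
    |(∫ t in (0 : ℝ)..1, (1 - t) * Real.sin (u₁ t))
        - (∫ t in (0 : ℝ)..1, (1 - t) * Real.sin (u₀ t))
        - ∫ t in (0 : ℝ)..1, (B₁ t - B₀ t) * (M₀ t * m t)|
      ≤ ((1 + β₁ / β₀) * C + 2 * (1 + β₁ / β₀) ^ 2 * (C + 1)) * ε ^ 2 := by
  set κ := 1 + β₁ / β₀ with hκ
  have hC : 0 ≤ C := (abs_nonneg _).trans (hw 0 (by simp))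
  have hβ₀ := hB₀.pos
  have hβ₁ := hB₀.upper_pos
  have hκ0 : 0 < κ := by positivity
  have hu : ∀ t ∈ Icc (0 : ℝ) 1, |u₁ t - u₀ t| ≤ κ * ε := fun t ht =>
    h₀.abs_sub_u_le hB₀ hB₁ h₁ hε hBε ht
  have hM : ∀ t ∈ Icc (0 : ℝ) 1, |M₁ t - M₀ t| ≤ κ * ε := fun t ht =>
    h₀.abs_sub_M_le h₁ hu ht
  rw [h₀.compliance_sub_eq hB₀ hB₁ h₁ ha]
  have r₁ : |∫ t in (0 : ℝ)..1, (B₁ t - B₀ t) * ((M₁ t - M₀ t) * m t)| ≤ κ * C * ε ^ 2 := by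
    have := intervalIntegral.norm_integral_le_of_norm_le_const_ae (a := 0) (b := 1)
      (f := fun t => (B₁ t - B₀ t) * ((M₁ t - M₀ t) * m t)) (C := κ * C * ε ^ 2) (by
        rw [ae_muI_iff] at hBε
        filter_upwards [hBε] with t ht htI
        rw [uIoc_of_le zero_le_one] at htI
        have htI' : t ∈ Icc (0 : ℝ) 1 := Ioc_subset_Icc_self htI
        rw [norm_mul, norm_mul, Real.norm_eq_abs, Real.norm_eq_abs, Real.norm_eq_abs]
        calc |B₁ t - B₀ t| * (|M₁ t - M₀ t| * |m t|) ≤ ε * (κ * ε * C) := by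
              apply mul_le_mul (ht htI) _ (by positivity) hε.le
              exact mul_le_mul (hM t htI') (hm t htI') (abs_nonneg _) (by positivity)
          _ = κ * C * ε ^ 2 := by ring)
    simpa using this
  have r₂ : |∫ t in (0 : ℝ)..1, (1 - t) *
          ((Real.cos (u₁ t) - Real.cos (u₀ t) + Real.sin (u₀ t) * (u₁ t - u₀ t)) * w t
            + (Real.sin (u₁ t) - Real.sin (u₀ t) - Real.cos (u₀ t) * (u₁ t - u₀ t)))|
      ≤ 2 * κ ^ 2 * (C + 1) * ε ^ 2 := by
    have := intervalIntegral.norm_integral_le_of_norm_le_const (a := 0) (b := 1)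
      (f := fun t => (1 - t) *
          ((Real.cos (u₁ t) - Real.cos (u₀ t) + Real.sin (u₀ t) * (u₁ t - u₀ t)) * w t
            + (Real.sin (u₁ t) - Real.sin (u₀ t) - Real.cos (u₀ t) * (u₁ t - u₀ t))))
      (C := 2 * κ ^ 2 * (C + 1) * ε ^ 2) (by
        intro t htI
        rw [uIoc_of_le zero_le_one] at htI
        have htI' : t ∈ Icc (0 : ℝ) 1 := Ioc_subset_Icc_self htI
        have hsq : (u₁ t - u₀ t) ^ 2 ≤ (κ * ε) ^ 2 := by
          rw [← sq_abs]; exact pow_le_pow_left₀ (abs_nonneg _) (hu t htI') 2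
        rw [Real.norm_eq_abs]
        refine abs_mul_le_of_abs_le_one
          (by rw [abs_of_nonneg (by linarith [htI.2])]; linarith [htI.1]) ?_
        refine (abs_add_le _ _).trans ?_
        rw [abs_mul]
        have a1 := (abs_cos_sub_le (u₁ t) (u₀ t)).trans (mul_le_mul_of_nonneg_left hsq zero_le_two)
        have a2 := (abs_sin_sub_le (u₁ t) (u₀ t)).trans (mul_le_mul_of_nonneg_left hsq zero_le_two)
        have a3 := mul_le_mul a1 (hw t htI') (abs_nonneg _) (by positivity)
        linarith)
    simpa using this
  have e : ∀ x y z : ℝ, x + y + z - x = y + z := fun x y z => by ring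
  rw [e]
  refine (abs_add_le _ _).trans ?_
  linarith

end

/-! ### Weak formulation and integrated form -/

theorem loadF_eq (t : ℝ) : loadF t = ((1 - t : ℝ) : ℂ) * -Complex.I := by
  simp [loadF, load]

theorem tangent_eq (K : ℝ → ℝ) (t : ℝ) : tangent K t = ⟨Real.cos (K t), Real.sin (K t)⟩ := by
  rw [tangent, mul_comm]
  exact Complex.ext (Complex.exp_ofReal_mul_I_re _) (Complex.exp_ofReal_mul_I_im _)

theorem inner_loadF_tangent (K : ℝ → ℝ) (t : ℝ) :
    inner ℝ (loadF t) (tangent K t) = (1 - t) * Real.sin (-K t) := by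
  rw [loadF_eq, tangent_eq, Complex.inner, Real.sin_neg]
  simp only [map_mul, map_neg, Complex.conj_ofReal, Complex.conj_I, Complex.mul_re, Complex.mul_im,
    Complex.neg_re, Complex.neg_im, Complex.ofReal_re, Complex.ofReal_im, Complex.I_re,
    Complex.I_im]
  ring

theorem inner_loadF_I_mul_tangent (K : ℝ → ℝ) (t : ℝ) :
    inner ℝ (loadF t) (Complex.I * tangent K t) = -((1 - t) * Real.cos (-K t)) := by
  rw [loadF_eq, tangent_eq, Complex.inner, Real.cos_neg]
  simp only [map_mul, map_neg, Complex.conj_ofReal, Complex.conj_I, Complex.mul_re, Complex.mul_im,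
    Complex.neg_re, Complex.neg_im, Complex.ofReal_re, Complex.ofReal_im, Complex.I_re,
    Complex.I_im]
  ring

/-- The reciprocal of `coeffA`, which is affine in `θ`. -/
def recipA (a b θ : ℝ) : ℝ := (1 - θ) / a + θ / b

/-- Primitives of `L²` functions are elements of `X`. -/
theorem memX_integral {g : ℝ → ℝ} (hg : MemLp g 2 muI) :
    MemX (fun t => ∫ s in (0 : ℝ)..t, g s) ∧
      deriv (fun t => ∫ s in (0 : ℝ)..t, g s) =ᵐ[muI] g := by
  have hi : IntervalIntegrable g volume 0 1 :=
    (intervalIntegrable_iff_muI _).2 (hg.integrable (by norm_num))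
  have hd : deriv (fun t => ∫ s in (0 : ℝ)..t, g s) =ᵐ[muI] g := by
    refine ae_muI_iff.2 ?_
    filter_upwards [hi.ae_hasDerivAt_integral] with t ht ht'
    rw [uIcc_of_le zero_le_one] at ht
    exact (ht (Ioc_subset_Icc_self ht') 0 (by simp)).deriv
  exact ⟨⟨hi.absolutelyContinuousOnInterval_intervalIntegral (by simp),
    (memLp_congr_ae hd).2 hg, intervalIntegral.integral_same⟩, hd⟩

theorem MemX.eq_integral {K : ℝ → ℝ} (hK : MemX K) {t : ℝ} (ht : t ∈ Icc (0 : ℝ) 1) :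
    K t = ∫ s in (0 : ℝ)..t, deriv K s := by
  have h : AbsolutelyContinuousOnInterval K 0 t := hK.absCont.mono (by
    rw [uIcc_of_le zero_le_one]; exact uIcc_subset_Icc (by simp) ht)
  rw [h.integral_deriv_eq_sub, hK.zero_left, sub_zero]

/-- Integration by parts of a load term against a test function. -/
theorem integral_mul_memX {f n φ : ℝ → ℝ} (hf : IntervalIntegrable f volume 0 1)
    (hn : ∀ t ∈ Icc (0 : ℝ) 1, n t = ∫ s in t..1, f s) (hφ : MemX φ) :
    ∫ t, f t * φ t ∂muI = ∫ t, n t * deriv φ t ∂muI := by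
  rw [integral_muI, integral_muI, integral_mul_eq_of_primitives hf
    hφ.absCont.intervalIntegrable_deriv (fun t ht => hφ.eq_integral ht) hn]
  simp only [mul_comm]

section
variable {a b β₀ β₁ : ℝ} {B u M : ℝ → ℝ} {θ : LInf} {K : ℝ → ℝ}

theorem memLp_coeff_mul (hB : IsCoeff β₀ β₁ B) (hM : Continuous M) :
    MemLp (fun t => B t * M t) 2 muI := by
  obtain ⟨C, hC⟩ := isCompact_Icc.exists_bound_of_continuousOn (hM.continuousOn (s := Icc 0 1))
  refine MemLp.of_bound (hB.meas.aestronglyMeasurable.mul hM.aestronglyMeasurable) (β₁ * C)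
    (ae_muI_mem_Icc.mono fun t ht => ?_)
  rw [norm_mul]
  exact mul_le_mul (hB.abs_le t) (hC t ht) (norm_nonneg _) hB.upper_pos.le

/-- A solution of the integrated system solves the weak state equation. -/
theorem IsStateSol.isState (hB : IsCoeff β₀ β₁ B) (hBθ : ∀ᵐ t ∂muI, B t = recipA a b (θ t))
    (h : IsStateSol B u M) :
    ∃ K, IsState a b θ K ∧ ∀ t ∈ Icc (0 : ℝ) 1, K t = -u t := by
  have hmem : MemLp (fun t => -(B t * M t)) 2 muI := (memLp_coeff_mul hB h.cont_M).neg
  obtain ⟨hX, hd⟩ := memX_integral hmem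
  set K : ℝ → ℝ := fun t => ∫ s in (0 : ℝ)..t, -(B s * M s) with hKdef
  have hKu : ∀ t ∈ Icc (0 : ℝ) 1, K t = -u t := fun t ht => by
    rw [h.u_eq t ht]; exact intervalIntegral.integral_neg
  refine ⟨K, ⟨⟨hX, fun t ht => ?_⟩, fun φ hφ => ?_⟩, hKu⟩
  · have htI := Ico_subset_Icc_self ht
    rw [hKu t htI]
    exact ⟨by linarith [h.lt_pi_div_two hB t htI], by linarith [(h.range t htI).1]⟩
  · have e1 : ∫ t, coeffA a b (θ t) * deriv K t * deriv φ t ∂muI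
        = -∫ t, M t * deriv φ t ∂muI := by
      rw [← integral_neg]
      apply integral_congr_ae
      filter_upwards [hBθ, hd] with t h1 h2
      have h3 : coeffA a b (θ t) = (B t)⁻¹ := by rw [h1]; rfl
      rw [h2, h3]
      have := (hB.apply_pos t).ne'
      field_simp
    have e2 : ∫ t, (inner ℝ (loadF t) (Complex.I * tangent K t)) * φ t ∂muI
        = -∫ t, stateRhs t (u t) * φ t ∂muI := by
      rw [← integral_neg]
      apply integral_congr_ae
      filter_upwards [ae_muI_mem_Icc] with t ht
      rw [inner_loadF_I_mul_tangent, hKu t ht, neg_neg, stateRhs, neg_mul]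
    rw [e1, e2, integral_mul_memX
      ((h.continuous_rhs continuous_stateRhs).intervalIntegrable 0 1) h.M_eq hφ]
    ring

/-- A weak solution of the state equation solves the integrated system. The test function is a
primitive of `A(θ) K' + M`. -/
theorem IsState.exists_isStateSol (hB : IsCoeff β₀ β₁ B)
    (hBθ : ∀ᵐ t ∂muI, B t = recipA a b (θ t)) (h : IsState a b θ K) :
    ∃ u M, IsStateSol B u M ∧ ∀ t ∈ Icc (0 : ℝ) 1, K t = -u t := by
  obtain ⟨⟨hX, hrange⟩, heq⟩ := h
  have hKc : ContinuousOn K (Icc 0 1) := by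
    have := hX.absCont.continuousOn
    rwa [uIcc_of_le zero_le_one] at this
  let p : ℝ → ℝ := fun t => projIcc 0 1 zero_le_one t
  have hp : Continuous p := continuous_subtype_val.comp continuous_projIcc
  have hpm : ∀ t, p t ∈ Icc (0 : ℝ) 1 := fun t => (projIcc 0 1 zero_le_one t).2
  have hpt : ∀ t ∈ Icc (0 : ℝ) 1, p t = t := fun t ht => by
    simp only [p, projIcc_of_mem zero_le_one ht]
  let u : ℝ → ℝ := fun t => -K (p t)
  have hu : Continuous u := (hKc.comp_continuous hp hpm).neg
  have huK : ∀ t ∈ Icc (0 : ℝ) 1, K t = -u t := fun t ht => by simp only [u, hpt t ht, neg_neg]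
  let M : ℝ → ℝ := fun t => ∫ r in t..1, stateRhs r (u r)
  have hrhs : Continuous fun r => stateRhs r (u r) :=
    continuous_stateRhs.comp (continuous_id.prodMk hu)
  have hM : Continuous M := by
    have h1 : Continuous fun t => ∫ r in (1 : ℝ)..t, stateRhs r (u r) :=
      intervalIntegral.continuous_primitive (fun x y => hrhs.intervalIntegrable x y) 1
    have h2 : M = fun t => -∫ r in (1 : ℝ)..t, stateRhs r (u r) :=
      funext fun t => intervalIntegral.integral_symm _ _
    rw [h2]; exact h1.neg
  have hurange : ∀ t ∈ Icc (0 : ℝ) 1, u t ∈ Icc 0 (Real.pi / 2) := by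
    have hcl : IsClosed (u ⁻¹' Icc 0 (Real.pi / 2)) := isClosed_Icc.preimage hu
    have h1 : Ico (0 : ℝ) 1 ⊆ u ⁻¹' Icc 0 (Real.pi / 2) := fun t ht => by
      have h2 := hrange t ht
      rw [huK t (Ico_subset_Icc_self ht)] at h2
      exact ⟨by linarith [h2.2], by linarith [h2.1]⟩
    have h2 := hcl.closure_subset_iff.2 h1
    rw [closure_Ico zero_ne_one] at h2
    exact h2
  -- With a primitive of `g` as test function the weak equation reads `∫ g² = 0`.
  let g : ℝ → ℝ := fun t => (B t)⁻¹ * deriv K t + M t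
  have hMmem : MemLp M 2 muI := by
    obtain ⟨C, hC⟩ := isCompact_Icc.exists_bound_of_continuousOn (hM.continuousOn (s := Icc 0 1))
    exact MemLp.of_bound hM.aestronglyMeasurable C (ae_muI_mem_Icc.mono fun t ht => hC t ht)
  have hBK : MemLp (fun t => (B t)⁻¹ * deriv K t) 2 muI := by
    refine hX.deriv_memLp.of_le_mul (c := β₀⁻¹)
      (hB.meas.inv.aestronglyMeasurable.mul hX.deriv_memLp.1)
      (Filter.Eventually.of_forall fun t => ?_)
    rw [norm_mul, Real.norm_eq_abs, abs_of_pos (inv_pos.2 (hB.apply_pos t))]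
    exact mul_le_mul_of_nonneg_right (inv_anti₀ hB.pos (hB.lower t)) (norm_nonneg _)
  have hg : MemLp g 2 muI := hBK.add hMmem
  obtain ⟨hφ, hdφ⟩ := memX_integral hg
  have hweak := heq _ hφ
  have e2 : ∫ t, (inner ℝ (loadF t) (Complex.I * tangent K t)) * (∫ s in (0 : ℝ)..t, g s) ∂muI
      = -∫ t, stateRhs t (u t) * (∫ s in (0 : ℝ)..t, g s) ∂muI := by
    rw [← integral_neg]
    apply integral_congr_ae
    filter_upwards [ae_muI_mem_Icc] with t ht
    rw [inner_loadF_I_mul_tangent, huK t ht, neg_neg, stateRhs, neg_mul]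
  have e1 : ∫ t, coeffA a b (θ t) * deriv K t * deriv (fun t => ∫ s in (0 : ℝ)..t, g s) t ∂muI
      = ∫ t, (B t)⁻¹ * deriv K t * g t ∂muI := by
    apply integral_congr_ae
    filter_upwards [hBθ, hdφ] with t h1 h2
    have h3 : coeffA a b (θ t) = (B t)⁻¹ := by rw [h1]; rfl
    rw [h2, h3]
  have e3 : ∫ t, M t * deriv (fun t => ∫ s in (0 : ℝ)..t, g s) t ∂muI = ∫ t, M t * g t ∂muI := by
    apply integral_congr_ae
    filter_upwards [hdφ] with t h2
    rw [h2]
  rw [e1, e2, integral_mul_memX (hrhs.intervalIntegrable 0 1) (n := M) (fun t _ => rfl) hφ, e3,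
    sub_neg_eq_add] at hweak
  have hzero : ∀ᵐ t ∂muI, g t = 0 := by
    have h1 : ∫ t, g t * g t ∂muI = 0 := by
      have i1 : Integrable (fun t => (B t)⁻¹ * deriv K t * g t) muI := hBK.integrable_mul hg
      have i2 : Integrable (fun t => M t * g t) muI := hMmem.integrable_mul hg
      rw [← hweak, ← integral_add i1 i2]
      exact integral_congr_ae (Filter.Eventually.of_forall fun t => add_mul _ _ _)
    have h2 := (integral_eq_zero_iff_of_nonneg (fun t => mul_self_nonneg (g t))
      (hg.integrable_mul hg)).1 h1
    exact h2.mono fun t ht => mul_self_eq_zero.1 ht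
  refine ⟨u, M, ⟨⟨hu, hM, fun t ht => ?_, fun t _ => rfl⟩, hurange⟩, huK⟩
  have h1 : u t = -K t := by rw [huK t ht, neg_neg]
  rw [h1, hX.eq_integral ht, ← intervalIntegral.integral_neg]
  apply intervalIntegral.integral_congr_ae
  filter_upwards [ae_muI_iff.1 hzero] with s hs hs'
  rw [uIoc_of_le ht.1] at hs'
  have h2 : (B s)⁻¹ * deriv K s + M s = 0 := hs ⟨hs'.1, hs'.2.trans ht.2⟩
  have h3 : M s = -((B s)⁻¹ * deriv K s) := by linarith
  rw [h3, mul_neg, mul_inv_cancel_left₀ (hB.apply_pos s).ne']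

/-- The reduced compliance in terms of any solution of the integrated system, which is unique. -/
theorem reducedCompliance_eq (hB : IsCoeff β₀ β₁ B) (hBθ : ∀ᵐ t ∂muI, B t = recipA a b (θ t))
    (h : IsStateSol B u M) (cl : ℝ) :
    reducedCompliance a b cl θ
      = (∫ t in (0 : ℝ)..1, (1 - t) * Real.sin (u t)) + cl * ∫ t, θ t ∂muI := by
  have hex : ∃ K, IsState a b θ K := (h.isState hB hBθ).imp fun K hK => hK.1
  have hst : IsState a b θ (state a b θ) := by
    rw [state, dif_pos hex]; exact hex.choose_spec
  obtain ⟨u', M', h', hK⟩ := hst.exists_isStateSol hB hBθ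
  rw [reducedCompliance, compliance, integral_muI]
  congr 1
  apply intervalIntegral.integral_congr
  intro t ht
  rw [uIcc_of_le zero_le_one] at ht
  simp only [inner_loadF_tangent, hK t ht, neg_neg]
  rw [h.unique hB hB h' (Filter.Eventually.of_forall fun _ => rfl) ht]

end

/-! ### Differentiability of the reduced compliance -/

theorem LInf.ae_abs_le (η : LInf) : ∀ᵐ t ∂muI, |η t| ≤ ‖η‖ := by
  have h := ae_le_eLpNormEssSup (f := η) (μ := muI)
  filter_upwards [h] with t ht
  rw [Lp.norm_def, eLpNorm_exponent_top, ← Real.norm_eq_abs, ← toReal_enorm]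
  refine ENNReal.toReal_mono ?_ ht
  rw [← eLpNorm_exponent_top]; exact Lp.eLpNorm_ne_top η

theorem LInf.integrable_mul (η : LInf) {g : ℝ → ℝ} (hg : Continuous g) :
    Integrable (fun t => g t * η t) muI := by
  have h1 : Integrable g muI := (intervalIntegrable_iff_muI g).1 (hg.intervalIntegrable 0 1)
  exact h1.mul_bdd (Lp.aestronglyMeasurable η) (η.ae_abs_le)

/-- The continuous linear functional `η ↦ ∫ g η` on `L^∞(I)` given by a continuous density. -/
def pairing (g : ℝ → ℝ) (hg : Continuous g) : LInf →L[ℝ] ℝ :=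
  LinearMap.mkContinuous
    { toFun := fun η => ∫ t, g t * η t ∂muI
      map_add' := fun η ξ => by
        rw [← integral_add (η.integrable_mul hg) (ξ.integrable_mul hg)]
        apply integral_congr_ae
        filter_upwards [Lp.coeFn_add η ξ] with t ht
        rw [ht, Pi.add_apply, mul_add]
      map_smul' := fun c η => by
        rw [RingHom.id_apply, smul_eq_mul, ← integral_const_mul]
        apply integral_congr_ae
        filter_upwards [Lp.coeFn_smul c η] with t ht
        rw [ht, Pi.smul_apply, smul_eq_mul]; ring }
    (∫ t, |g t| ∂muI) (fun η => by
      have h1 : Integrable g muI := (intervalIntegrable_iff_muI g).1 (hg.intervalIntegrable 0 1)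
      rw [← integral_mul_const]
      refine norm_integral_le_of_norm_le (h1.abs.mul_const _) ?_
      filter_upwards [η.ae_abs_le] with t ht
      rw [norm_mul]
      exact mul_le_mul_of_nonneg_left ht (abs_nonneg _))

theorem pairing_apply (g : ℝ → ℝ) (hg : Continuous g) (η : LInf) :
    pairing g hg η = ∫ t, g t * η t ∂muI := rfl

/-- An everywhere defined version of `t ↦ 1 / A(θ t)` with values in `[β₀, β₁]`. -/
def coeffOf (a b β₀ β₁ : ℝ) (θ : LInf) (t : ℝ) : ℝ := max β₀ (min β₁ (recipA a b (θ t)))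

section
variable {a b β₀ β₁ : ℝ} {θ : LInf}

theorem isCoeff_coeffOf (h₀ : 0 < β₀) (h₁ : β₀ ≤ β₁) : IsCoeff β₀ β₁ (coeffOf a b β₀ β₁ θ) where
  meas := by
    have : Measurable θ := (Lp.stronglyMeasurable θ).measurable
    unfold coeffOf recipA
    fun_prop
  pos := h₀
  lower _ := le_max_left _ _
  upper _ := max_le h₁ (min_le_left _ _)

theorem coeffOf_eq (h : ∀ᵐ t ∂muI, recipA a b (θ t) ∈ Icc β₀ β₁) :
    ∀ᵐ t ∂muI, coeffOf a b β₀ β₁ θ t = recipA a b (θ t) :=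
  h.mono fun t ht => by rw [coeffOf, min_eq_right ht.2, max_eq_right ht.1]

theorem recipA_sub (a b x y : ℝ) : recipA a b x - recipA a b y = -(1 / a - 1 / b) * (x - y) := by
  unfold recipA; ring

/-- Bounds for `1 / A(θ')` in a neighbourhood of the admissible designs. -/
theorem recipA_mem_of_norm_sub_lt (ha : 0 < a) (hab : a < b) (hθ : θ ∈ admissible) {θ' : LInf}
    (h : ‖θ' - θ‖ < a / (2 * b)) :
    ∀ᵐ t ∂muI, recipA a b (θ' t) ∈ Icc (1 / (2 * b)) (1 / a + 1 / (2 * b)) := by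
  have hb : 0 < b := ha.trans hab
  have hκ : 0 < 1 / a - 1 / b := sub_pos.2 (one_div_lt_one_div_of_lt ha hab)
  have hκa : (1 / a - 1 / b) * (a / (2 * b)) ≤ 1 / (2 * b) := by
    have e : (1 / a - 1 / b) * (a / (2 * b)) = 1 / (2 * b) - a / (2 * b ^ 2) := by field_simp
    have : 0 < a / (2 * b ^ 2) := by positivity
    linarith
  filter_upwards [hθ, (θ' - θ).ae_abs_le, Lp.coeFn_sub θ' θ] with t h1 h2 h3
  rw [h3, Pi.sub_apply] at h2
  have h4 := recipA_sub a b (θ' t) (θ t)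
  have h5 : |(1 / a - 1 / b) * (θ' t - θ t)| ≤ 1 / (2 * b) := by
    rw [abs_mul, abs_of_pos hκ]
    exact (mul_le_mul_of_nonneg_left (h2.trans h.le) hκ.le).trans hκa
  have h6 := abs_le.1 h5
  have e7 : recipA a b (θ t) = 1 / b + (1 / a - 1 / b) * (1 - θ t) := by unfold recipA; ring
  have e8 : recipA a b (θ t) = 1 / a - (1 / a - 1 / b) * θ t := by unfold recipA; ring
  have h7 : 0 ≤ (1 / a - 1 / b) * (1 - θ t) := mul_nonneg hκ.le (by linarith [h1.2])
  have h8 : 0 ≤ (1 / a - 1 / b) * θ t := mul_nonneg hκ.le h1.1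
  have e9 : 1 / b = 1 / (2 * b) + 1 / (2 * b) := by field_simp; norm_num
  constructor <;> linarith

/-- The derivative of the reduced compliance at a design near which `1 / A` is bounded above and away
from zero. Only the difference to the first-order term matters, and that is quadratic. -/
theorem hasFDerivAt_reducedCompliance (ha : 0 < a) (hab : a < b) (cl : ℝ)
    (h₀ : 0 < β₀) (h₁ : β₀ ≤ β₁)
    (hβ : ∀ᶠ θ' in 𝓝 θ, ∀ᵐ t ∂muI, recipA a b (θ' t) ∈ Icc β₀ β₁) {u M w m : ℝ → ℝ}
    (hs : IsStateSol (coeffOf a b β₀ β₁ θ) u M)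
    (had : IsSol (coeffOf a b β₀ β₁ θ) (adjRhs u) w m)
    (hg : Continuous fun t => cl - (1 / a - 1 / b) * (M t * m t)) :
    HasFDerivAt (reducedCompliance a b cl)
      (pairing (fun t => cl - (1 / a - 1 / b) * (M t * m t)) hg) θ := by
  set κ := 1 / a - 1 / b with hκdef
  have hκ : 0 < κ := sub_pos.2 (one_div_lt_one_div_of_lt ha hab)
  have hB := isCoeff_coeffOf (a := a) (b := b) (θ := θ) h₀ h₁
  have hBθ := coeffOf_eq hβ.self_of_nhds
  obtain ⟨C₁, hC₁⟩ := isCompact_Icc.exists_bound_of_continuousOn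
    (had.cont_u.continuousOn (s := Icc 0 1))
  obtain ⟨C₂, hC₂⟩ := isCompact_Icc.exists_bound_of_continuousOn
    (had.cont_M.continuousOn (s := Icc 0 1))
  set C := max C₁ C₂ with hC
  set D := ((1 + β₁ / β₀) * C + 2 * (1 + β₁ / β₀) ^ 2 * (C + 1)) * κ ^ 2 with hD
  apply HasFDerivAt.of_isLittleO
  have hO : (fun θ' => reducedCompliance a b cl θ' - reducedCompliance a b cl θ
      - pairing (fun t => cl - κ * (M t * m t)) hg (θ' - θ)) =O[𝓝 θ] fun θ' => ‖θ' - θ‖ ^ 2 := by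
    apply Asymptotics.IsBigO.of_bound D
    filter_upwards [hβ] with θ' hθ'
    rcases eq_or_ne θ' θ with rfl | hne
    · simp
    have hB' := isCoeff_coeffOf (a := a) (b := b) (θ := θ') h₀ h₁
    have hBθ' := coeffOf_eq hθ'
    obtain ⟨u', M', hs'⟩ := exists_isStateSol hB'
    have hpos : 0 < ‖θ' - θ‖ := norm_pos_iff.2 (sub_ne_zero.2 hne)
    have hdiff : ∀ᵐ t ∂muI, coeffOf a b β₀ β₁ θ' t - coeffOf a b β₀ β₁ θ t
        = -κ * (θ' - θ : LInf) t := by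
      filter_upwards [hBθ, hBθ', Lp.coeFn_sub θ' θ] with t h1 h2 h3
      rw [h1, h2, h3, Pi.sub_apply, recipA_sub]
    have hrem := hs.abs_compliance_remainder_le hB hB' hs' had (ε := κ * ‖θ' - θ‖) (C := C)
      (by positivity) (by
        filter_upwards [hdiff, (θ' - θ).ae_abs_le] with t h1 h2
        rw [h1, abs_mul, abs_neg, abs_of_pos hκ]
        exact mul_le_mul_of_nonneg_left h2 hκ.le)
      (fun t ht => (hC₁ t ht).trans (le_max_left _ _))
      (fun t ht => (hC₂ t ht).trans (le_max_right _ _))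
    have hMm : Continuous fun t => M t * m t := hs.cont_M.mul had.cont_M
    have e1 : ∫ t in (0 : ℝ)..1, (coeffOf a b β₀ β₁ θ' t - coeffOf a b β₀ β₁ θ t) * (M t * m t)
        = -κ * ∫ t, (M t * m t) * (θ' - θ : LInf) t ∂muI := by
      rw [← integral_muI, ← integral_const_mul]
      apply integral_congr_ae
      filter_upwards [hdiff] with t h1
      rw [h1]; ring
    have e2 : pairing (fun t => cl - κ * (M t * m t)) hg (θ' - θ)
        = cl * ((∫ t, θ' t ∂muI) - ∫ t, θ t ∂muI)
          - κ * ∫ t, (M t * m t) * (θ' - θ : LInf) t ∂muI := by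
      have i1 : Integrable θ' muI := by simpa using θ'.integrable_mul (continuous_const (y := 1))
      have i2 : Integrable θ muI := by simpa using θ.integrable_mul (continuous_const (y := 1))
      have i3 : Integrable (fun t => cl * (θ' t - θ t)) muI := (i1.sub i2).const_mul cl
      rw [pairing_apply, ← integral_sub i1 i2, ← integral_const_mul, ← integral_const_mul,
        ← integral_sub i3 (((θ' - θ).integrable_mul hMm).const_mul κ)]
      apply integral_congr_ae
      filter_upwards [Lp.coeFn_sub θ' θ] with t h3
      simp only [h3, Pi.sub_apply]
      ring
    rw [e1] at hrem
    rw [reducedCompliance_eq hB' hBθ' hs' cl, reducedCompliance_eq hB hBθ hs cl, e2,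
      Real.norm_eq_abs, Real.norm_eq_abs, abs_of_nonneg (sq_nonneg ‖θ' - θ‖)]
    have e3 : ((1 + β₁ / β₀) * C + 2 * (1 + β₁ / β₀) ^ 2 * (C + 1)) * (κ * ‖θ' - θ‖) ^ 2
        = D * ‖θ' - θ‖ ^ 2 := by rw [hD]; ring
    rw [e3] at hrem
    refine le_trans (le_of_eq ?_) hrem
    congr 1
    ring
  exact hO.trans_isLittleO (Asymptotics.isLittleO_pow_sub_sub θ one_lt_two)

/-! ### Optimal designs -/

/-- The characteristic function of `(0,T)`: the hard phase first, then the soft one. -/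
def orderedDesign (T : ℝ) : LInf :=
  indicatorConstLp ∞ (measurableSet_Ioo : MeasurableSet (Ioo (0 : ℝ) T)) (measure_ne_top _ _)
    (1 : ℝ)

theorem coeFn_orderedDesign (T : ℝ) :
    orderedDesign T =ᵐ[muI] (Ioo (0 : ℝ) T).indicator fun _ => 1 := indicatorConstLp_coeFn

theorem orderedDesign_mem (T : ℝ) : orderedDesign T ∈ admissible := by
  filter_upwards [coeFn_orderedDesign T] with t ht
  rw [ht]
  by_cases h : t ∈ Ioo 0 T <;> simp [h]

theorem convex_admissible : Convex ℝ admissible := by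
  intro θ hθ ξ hξ x y hx hy hxy
  filter_upwards [hθ, hξ, Lp.coeFn_add (x • θ) (y • ξ), Lp.coeFn_smul x θ, Lp.coeFn_smul y ξ]
    with t h1 h2 h3 h4 h5
  rw [h3, Pi.add_apply, h4, h5]
  exact convex_Icc (0 : ℝ) 1 h1 h2 hx hy hxy

/-- The variational inequality, common to critical points and minimisers: `χ - θ` is an admissible
direction for the former and tangent to the convex set of designs for the latter. -/
theorem fderiv_sub_nonneg {cl : ℝ} (hd : DifferentiableAt ℝ (reducedCompliance a b cl) θ)
    (hθ : θ ∈ admissible)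
    (h : IsCritical a b cl θ ∨ IsMinOn (reducedCompliance a b cl) admissible θ) {χ : LInf}
    (hχ : χ ∈ admissible) : 0 ≤ fderiv ℝ (reducedCompliance a b cl) θ (χ - θ) := by
  rcases h with h | h
  · apply h
    · filter_upwards [hχ, Lp.coeFn_sub χ θ] with t h1 h2 h3
      rw [h2, Pi.sub_apply, h3, sub_zero]; exact h1.1
    · filter_upwards [hχ, Lp.coeFn_sub χ θ] with t h1 h2 h3
      rw [h2, Pi.sub_apply, h3]; linarith [h1.2]
  · exact h.localize.hasFDerivWithinAt_nonneg hd.hasFDerivAt.hasFDerivWithinAt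
      (sub_mem_posTangentConeAt_of_segment_subset (convex_admissible.segment_subset hθ hχ))

/-- A design that satisfies the variational inequality with a density `g` changing sign once, from
negative to positive, is ordered. -/
theorem eq_orderedDesign_of_pairing_nonneg {g : ℝ → ℝ} (hg : Continuous g) (hθ : θ ∈ admissible)
    {T : ℝ} (hneg : ∀ t ∈ Ioo 0 T, g t < 0) (hpos : ∀ t ∈ Ioo T 1, 0 < g t)
    (h : 0 ≤ pairing g hg (orderedDesign T - θ)) :
    ∀ᵐ t ∂muI, θ t = (Ioo (0 : ℝ) T).indicator (fun _ => 1) t := by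
  have hT : ∀ᵐ t ∂muI, t ≠ T := ae_restrict_of_ae (by simp [ae_iff])
  have hsign : ∀ᵐ t ∂muI, g t * (orderedDesign T - θ : LInf) t ≤ 0 ∧
      (g t * (orderedDesign T - θ : LInf) t = 0 →
        θ t = (Ioo (0 : ℝ) T).indicator (fun _ => 1) t) := by
    filter_upwards [hT, ae_muI_mem, hθ, coeFn_orderedDesign T,
      Lp.coeFn_sub (orderedDesign T) θ] with t h1 h2 h3 h4 h5
    rw [h5, Pi.sub_apply, h4]
    rcases lt_or_gt_of_ne h1 with h6 | h6
    · have h7 : t ∈ Ioo 0 T := ⟨h2.1, h6⟩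
      have h8 := hneg t h7
      rw [indicator_of_mem h7]
      refine ⟨mul_nonpos_of_nonpos_of_nonneg h8.le (by linarith [h3.2]), fun h9 => ?_⟩
      linarith [(mul_eq_zero.1 h9).resolve_left h8.ne]
    · have h7 : t ∉ Ioo 0 T := fun h => absurd h.2 (not_lt.2 h6.le)
      have h8 := hpos t ⟨h6, h2.2⟩
      rw [indicator_of_notMem h7]
      refine ⟨mul_nonpos_of_nonneg_of_nonpos h8.le (by linarith [h3.1]), fun h9 => ?_⟩
      linarith [(mul_eq_zero.1 h9).resolve_left h8.ne']
  have hint := (orderedDesign T - θ).integrable_mul hg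
  have hnn : 0 ≤ᵐ[muI] fun t => -(g t * (orderedDesign T - θ : LInf) t) :=
    hsign.mono fun t ht => neg_nonneg.2 ht.1
  have hz : ∫ t, -(g t * (orderedDesign T - θ : LInf) t) ∂muI = 0 := by
    refine le_antisymm ?_ (integral_nonneg_of_ae hnn)
    rw [integral_neg]
    rw [pairing_apply] at h
    linarith
  have hzero := (integral_eq_zero_iff_of_nonneg_ae hnn hint.neg).1 hz
  filter_upwards [hsign, hzero] with t h1 h2
  exact h1.2 (neg_eq_zero.1 h2)

end

end Beam

end

theorem mainTheorem1 (a b : ℝ) (ha : 0 < a) (hab : a < b) :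
    ∃ c₀ : ℝ, 0 < c₀ ∧ ∀ cl : ℝ, 0 < cl → ∀ θ : Beam.LInf, θ ∈ Beam.admissible →
      (∀ᶠ θ' in nhds θ, ∃ K : ℝ → ℝ, Beam.IsState a b θ' K ∧
        ∀ K' : ℝ → ℝ, Beam.IsState a b θ' K' → Set.EqOn K' K (Set.Icc 0 1)) ∧
      DifferentiableAt ℝ (Beam.reducedCompliance a b cl) θ ∧
      (Beam.IsCritical a b cl θ ∨
          IsMinOn (Beam.reducedCompliance a b cl) Beam.admissible θ →
        ∃ tstar : ℝ, 0 ≤ tstar ∧ tstar < 1 ∧ (cl < c₀ → 0 < tstar) ∧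
          (∀ᵐ t ∂(MeasureTheory.volume.restrict (Set.Ioo 0 tstar)),
            Beam.coeffA a b (θ t) = b) ∧
          (∀ᵐ t ∂(MeasureTheory.volume.restrict (Set.Ioo tstar 1)),
            Beam.coeffA a b (θ t) = a)) := by
  have hb : 0 < b := ha.trans hab
  have hκ : 0 < 1 / a - 1 / b := sub_pos.2 (one_div_lt_one_div_of_lt ha hab)
  set κ := 1 / a - 1 / b with hκdef
  -- On admissible designs `1 / A` lies in `[1/b, 1/a]`; the margin `1 / (2 b)` leaves room for an
  -- `L^∞`-neighbourhood.
  set β₀ := 1 / (2 * b) with hβ₀def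
  set β₁ := 1 / a + 1 / (2 * b) with hβ₁def
  have hβ₀ : 0 < β₀ := by positivity
  have hβ₁ : β₀ ≤ β₁ := by
    have : 0 < 1 / a := by positivity
    linarith
  refine ⟨κ * Beam.sensitivityBound β₀ β₁,
    mul_pos hκ (Beam.sensitivityBound_pos hβ₀ (hβ₀.trans_le hβ₁)), fun cl hcl θ hθ => ?_⟩
  have hnhds : ∀ᶠ θ' in nhds θ, ∀ᵐ t ∂Beam.muI, Beam.recipA a b (θ' t) ∈ Set.Icc β₀ β₁ := by
    filter_upwards [Metric.ball_mem_nhds θ (by positivity : 0 < a / (2 * b))] with θ' hθ'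
    exact Beam.recipA_mem_of_norm_sub_lt ha hab hθ (by rwa [← dist_eq_norm])
  have hB := Beam.isCoeff_coeffOf (a := a) (b := b) (θ := θ) hβ₀ hβ₁
  obtain ⟨u, M, hs⟩ := Beam.exists_isStateSol hB
  obtain ⟨w, m, had⟩ := hs.exists_adjoint hB
  have hg : Continuous fun t => cl - κ * (M t * m t) := by
    have := hs.cont_M
    have := had.cont_M
    fun_prop
  have hderiv := Beam.hasFDerivAt_reducedCompliance ha hab cl hβ₀ hβ₁ hnhds hs had hg
  refine ⟨?_, hderiv.differentiableAt, fun hopt => ?_⟩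
  · filter_upwards [hnhds] with θ' hθ'
    have hB' := Beam.isCoeff_coeffOf (a := a) (b := b) (θ := θ') hβ₀ hβ₁
    have hBθ' := Beam.coeffOf_eq hθ'
    obtain ⟨u', M', hs'⟩ := Beam.exists_isStateSol hB'
    obtain ⟨K, hK, hKu⟩ := hs'.isState hB' hBθ'
    refine ⟨K, hK, fun K' hK' t ht => ?_⟩
    obtain ⟨u'', M'', hs'', hKu'⟩ := hK'.exists_isStateSol hB' hBθ'
    rw [hKu t ht, hKu' t ht,
      hs'.unique hB' hB' hs'' (Filter.Eventually.of_forall fun _ => rfl) ht]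
  · -- The density `cl - κ M m` of the derivative vanishes at the level `cl / κ` of `M m`.
    obtain ⟨T, hT0, hT1, hTpos, hlt, hgt⟩ := hs.exists_threshold hB had (div_pos hcl hκ)
    have hvar := Beam.fderiv_sub_nonneg hderiv.differentiableAt hθ hopt (Beam.orderedDesign_mem T)
    rw [hderiv.fderiv] at hvar
    have hord := Beam.eq_orderedDesign_of_pairing_nonneg hg hθ
      (fun t ht => by
        have := (div_lt_iff₀' hκ).1 (hlt t ht)
        linarith)
      (fun t ht => by
        have := (lt_div_iff₀' hκ).1 (hgt t ht)
        linarith) hvar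
    refine ⟨T, hT0, hT1, fun hcl₀ => hTpos ?_, ?_, ?_⟩
    · rw [div_lt_iff₀' hκ]
      exact hcl₀.trans_le (mul_le_mul_of_nonneg_left (hs.sensitivityBound_le hB had) hκ.le)
    · have h1 := MeasureTheory.ae_restrict_of_ae_restrict_of_subset
        (Set.Ioo_subset_Ioo_right hT1.le) hord
      filter_upwards [h1, MeasureTheory.ae_restrict_mem measurableSet_Ioo] with t h2 h3
      rw [h2, Set.indicator_of_mem h3, Beam.coeffA]
      simp
    · have h1 := MeasureTheory.ae_restrict_of_ae_restrict_of_subset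
        (Set.Ioo_subset_Ioo_left hT0) hord
      filter_upwards [h1, MeasureTheory.ae_restrict_mem measurableSet_Ioo] with t h2 h3
      rw [h2, Set.indicator_of_notMem fun h => absurd h.2 (not_lt.2 h3.1.le), Beam.coeffA]
      simp
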